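/- There are a program $p$, an integer $K$ and a real constant $C$ such that the following holds for every $n\ge 2$ and every probability distribution $\mu$ on regular bipartite graphs with $2n$ nodes given in adjacency array representation. Here a regular bipartite graph with $2n$ nodes is $G=(P,Q,E)$ with $|P|=|Q|=n$ and $E\subseteq P\times Q$ such that all nodes have the same degree $d\ge 1$ ($d$ may vary with $G$). It is given by $n$, $d$ and, for every node, an array listing its $d$ neighbours in an arbitrary order; $\mu$ is a distribution on graphs together with such arrays. There is a deterministic algorithm $A_\mu$ which finds a perfect matching of every such graph, and whose average running time on inputs drawn from $\mu$ is at most $C\,n\log n$. Here $A_\mu$ is a word RAM algorithm with words of $K\lceil\log_2(n+1)\rceil=O(\log n)$ bits. It runs the program $p$, which depends neither on $n$ nor on $\mu$, with a read-only table of constants that is hard-wired into the algorithm, may depend on $n$ and $\mu$, and consists of at most $2^{K\lceil\log_2(n+1)\rceil}=n^{O(1)}$ words. All registers and memory cells are initially $0$. Running time is the number of executed instructions: each arithmetic operation or comparison on words, memory access, probe of an adjacency array entry, read of $n$ or of $d$, table read, and test costs one step. -/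

import Mathlib

open scoped ENNReal

namespace RegMatch

/-! ### Regular bipartite graphs and their adjacency arrays -/

/-- A `d`-regular bipartite graph `G = (P, Q, E)` with `P = Q = Fin n` (two disjoint copies, so
`2n` nodes), given by its edge set `E ⊆ P × Q`. -/
structure RegBipGraph (n d : ℕ) where
  edges : Finset (Fin n × Fin n)
  left_degree : ∀ u : Fin n, (Finset.univ.filter fun v : Fin n => (u, v) ∈ edges).card = d
  right_degree : ∀ v : Fin n, (Finset.univ.filter fun u : Fin n => (u, v) ∈ edges).card = d

/-- An adjacency array representation of `G`: for each vertex of `P` and of `Q`, an array that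
lists its `d` neighbours, each once, in an arbitrary order. -/
structure AdjArrays {n d : ℕ} (G : RegBipGraph n d) where
  left : Fin n → Fin d → Fin n
  right : Fin n → Fin d → Fin n
  left_injective : ∀ u, Function.Injective (left u)
  right_injective : ∀ v, Function.Injective (right v)
  left_spec : ∀ u v, (u, v) ∈ G.edges ↔ ∃ i, left u i = v
  right_spec : ∀ u v, (u, v) ∈ G.edges ↔ ∃ i, right v i = u

/-- An input: a regular bipartite graph with `2n` nodes, of some degree `d ≥ 1`, given in
adjacency array representation. -/
structure Input (n : ℕ) where
  d : ℕ
  d_pos : 1 ≤ d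
  graph : RegBipGraph n d
  arrays : AdjArrays graph

/-- `M` is a perfect matching of `G`: a set of edges of `G` such that every node of `P` and every
node of `Q` is on exactly one edge of `M`. -/
def IsPerfectMatching {n d : ℕ} (G : RegBipGraph n d) (M : Finset (Fin n × Fin n)) : Prop :=
  M ⊆ G.edges ∧ (∀ u, ∃! v, (u, v) ∈ M) ∧ (∀ v, ∃! u, (u, v) ∈ M)

/-! ### A deterministic word RAM with structured control flow and unit-cost instructions -/

/-- Binary operations on words. -/
inductive BinOp where
  | add | sub | mul | div | mod | lt | eq

/-- Arithmetic is on natural numbers (subtraction is truncated); results are reduced to a word when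
they are stored in a register. Comparisons return `1` for true and `0` for false. -/
def BinOp.eval : BinOp → ℕ → ℕ → ℕ
  | .add, a, b => a + b
  | .sub, a, b => a - b
  | .mul, a, b => a * b
  | .div, a, b => a / b
  | .mod, a, b => a % b
  | .lt, a, b => if a < b then 1 else 0
  | .eq, a, b => if a = b then 1 else 0

/-- Elementary instructions. The arguments `x y z` are names of registers. -/
inductive Instr where
  /-- `r[x] := c` -/
  | const (x c : ℕ)
  /-- `r[x] := r[y] o r[z]` -/
  | bin (o : BinOp) (x y z : ℕ)
  /-- `r[x] := mem[r[y]]` -/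
  | load (x y : ℕ)
  /-- `mem[r[x]] := r[y]` -/
  | store (x y : ℕ)
  /-- `r[x] := n`, the number of nodes on each side of the input graph -/
  | size (x : ℕ)
  /-- `r[x] := d`, the degree of the input graph -/
  | degree (x : ℕ)
  /-- `r[x] :=` entry `r[z]` of the adjacency array of the node `r[y]` of `P` -/
  | probeLeft (x y z : ℕ)
  /-- `r[x] :=` entry `r[z]` of the adjacency array of the node `r[y]` of `Q` -/
  | probeRight (x y z : ℕ)
  /-- `r[x] :=` entry `r[y]` of the table of constants of the algorithm -/
  | const_table (x y : ℕ)

/-- Programs. A test asks whether the register `y` is nonzero. -/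
inductive Prog where
  | instr (i : Instr)
  | seq (p q : Prog)
  | ite (y : ℕ) (p q : Prog)
  | while (y : ℕ) (p : Prog)

/-- A memory state of the machine: registers and random access memory. -/
structure State where
  reg : ℕ → ℕ
  mem : ℕ → ℕ

/-- All registers and memory cells are `0` at the start. -/
def State.init : State := ⟨fun _ => 0, fun _ => 0⟩

/-- Write `a` to the register `x`, reduced to a word of `w` bits. -/
def State.setReg (s : State) (w x a : ℕ) : State :=
  { s with reg := Function.update s.reg x (a % 2 ^ w) }

/-- An entry of an array of size `n × d`; positions outside of the array read as `0`. -/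
def entry {n d : ℕ} (A : Fin n → Fin d → Fin n) (a b : ℕ) : ℕ :=
  if h : a < n ∧ b < d then (A ⟨a, h.1⟩ ⟨b, h.2⟩ : ℕ) else 0

/-- The effect of an elementary instruction, on input `I`, with words of `w` bits and with the
read-only table `tbl`. -/
def Instr.run {n : ℕ} (I : Input n) (w : ℕ) (tbl : List ℕ) (s : State) : Instr → State
  | .const x c => s.setReg w x c
  | .bin o x y z => s.setReg w x (o.eval (s.reg y) (s.reg z))
  | .load x y => s.setReg w x (s.mem (s.reg y))
  | .store x y => { s with mem := Function.update s.mem (s.reg x) (s.reg y) }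
  | .size x => s.setReg w x n
  | .degree x => s.setReg w x I.d
  | .probeLeft x y z => s.setReg w x (entry I.arrays.left (s.reg y) (s.reg z))
  | .probeRight x y z => s.setReg w x (entry I.arrays.right (s.reg y) (s.reg z))
  | .const_table x y => s.setReg w x (tbl.getD (s.reg y) 0)

/-- `Exec I w tbl p s t s'`: on input `I`, with words of `w` bits and the table `tbl`, the program
`p` started in the state `s` halts in the state `s'` after exactly `t` steps. Each elementary
instruction and each evaluation of a test is one step. -/
inductive Exec {n : ℕ} (I : Input n) (w : ℕ) (tbl : List ℕ) :
    Prog → State → ℕ → State → Prop where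
  | instr (i : Instr) (s : State) : Exec I w tbl (.instr i) s 1 (i.run I w tbl s)
  | seq {p q : Prog} {s s' s'' : State} {t t' : ℕ} :
      Exec I w tbl p s t s' → Exec I w tbl q s' t' s'' → Exec I w tbl (.seq p q) s (t + t') s''
  | ite_true {y : ℕ} {p q : Prog} {s s' : State} {t : ℕ} :
      s.reg y ≠ 0 → Exec I w tbl p s t s' → Exec I w tbl (.ite y p q) s (t + 1) s'
  | ite_false {y : ℕ} {p q : Prog} {s s' : State} {t : ℕ} :
      s.reg y = 0 → Exec I w tbl q s t s' → Exec I w tbl (.ite y p q) s (t + 1) s'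
  | while_true {y : ℕ} {p : Prog} {s s' s'' : State} {t t' : ℕ} :
      s.reg y ≠ 0 → Exec I w tbl p s t s' → Exec I w tbl (.while y p) s' t' s'' →
      Exec I w tbl (.while y p) s (t + t' + 1) s''
  | while_false {y : ℕ} {p : Prog} {s : State} :
      s.reg y = 0 → Exec I w tbl (.while y p) s 1 s

/-- The machine is deterministic: input, words, table and program determine the running time and
the final state. -/
theorem Exec.deterministic {n : ℕ} {I : Input n} {w : ℕ} {tbl : List ℕ} {p : Prog}
    {s s₁ s₂ : State} {t₁ t₂ : ℕ} (h₁ : Exec I w tbl p s t₁ s₁) (h₂ : Exec I w tbl p s t₂ s₂) :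
    t₁ = t₂ ∧ s₁ = s₂ := by
  induction h₁ generalizing t₂ s₂ with
  | instr i s => cases h₂; exact ⟨rfl, rfl⟩
  | seq _ _ ih ih' =>
    cases h₂ with
    | seq a b =>
      obtain ⟨rfl, rfl⟩ := ih a
      obtain ⟨rfl, rfl⟩ := ih' b
      exact ⟨rfl, rfl⟩
  | ite_true hy _ ih =>
    cases h₂ with
    | ite_true _ a => obtain ⟨rfl, rfl⟩ := ih a; exact ⟨rfl, rfl⟩
    | ite_false h _ => exact absurd h hy
  | ite_false hy _ ih =>
    cases h₂ with
    | ite_true h _ => exact absurd hy h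
    | ite_false _ a => obtain ⟨rfl, rfl⟩ := ih a; exact ⟨rfl, rfl⟩
  | while_true hy _ _ ih ih' =>
    cases h₂ with
    | while_true _ a b =>
      obtain ⟨rfl, rfl⟩ := ih a
      obtain ⟨rfl, rfl⟩ := ih' b
      exact ⟨rfl, rfl⟩
    | while_false h => exact absurd h hy
  | while_false hy =>
    cases h₂ with
    | while_true h _ _ => exact absurd hy h
    | while_false _ => exact ⟨rfl, rfl⟩

/-- On input `I`, the program `p` with words of `w` bits and table `tbl` halts after `t` steps and
outputs a perfect matching of the input graph: for every node `u` of `P`, the memory cell `u` holds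
the node of `Q` that is matched to `u`. -/
def FindsPerfectMatchingIn {n : ℕ} (I : Input n) (w : ℕ) (tbl : List ℕ) (p : Prog) (t : ℕ) :
    Prop :=
  ∃ s : State, Exec I w tbl p State.init t s ∧
    ∃ M : Finset (Fin n × Fin n), IsPerfectMatching I.graph M ∧
      ∀ e ∈ M, s.mem (e.1 : ℕ) = (e.2 : ℕ)

/-- Number of bits of a word, `K` times the length of `n` in binary. -/
def wordBits (K n : ℕ) : ℕ := K * Nat.size n

end RegMatch

/-! The algorithm augments along random walks, with its coin tosses read from the table. A round
draws a uniform node of `P` and does nothing if that node is matched. Otherwise it walks: from a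
node of `P` go to a uniform neighbour in `Q`; stop if that is free, else follow its matching edge
back to `P`. The walk is cut off after `2 * n` steps. If it reaches a free node, following from each
node its last exit gives the loop-erased walk, an augmenting path.

The key estimate is Kac's: by regularity the uniform measure is preserved by a step, so the mean
lengths of the walks from all unmatched nodes add up to at most `n` (`sum_walkSum_le`). Hence a
round costs at most 2 on average (`sum_roundCost_le`), and by Markov's inequality it succeeds with
probability at least `k / (2n)` when `k` nodes are unmatched (`deficit_mul_card_le`). Summing the
waiting times gives mean total cost at most `4 n H_n` (`sum_runCost_le`), and failure after `T`
rounds has probability at most `2^n (1 - 1/(4n))^T` (`card_runEnd_ne_zero_le`).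

For `T = 16 n^4` this beats the number of possible adjacency arrays, so at least half of all choice
sequences succeed on every input, inside or outside the support of `μ`
(`card_le_two_mul_card_universal`). The cost averaged over `μ` and over all sequences is at most `4
n H_n`, so some universal sequence has `μ`-average at most twice that (`exists_universal_choices`).
It becomes the table. The remaining work shows that the machine simulates the rounds with constant
overhead (`exec_matchingProg`). -/

namespace RegMatch

/-! ### Matchings, the random walk and augmentation along last exits -/

/-- A matching under construction: `mate v` is the partner of the node `v` of `Q`, `left u` the
partner of a matched node `u` of `P`, and `next u` the node of `Q` to which a walk last left `u`. -/
@[ext] structure MState (n : ℕ) where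
  mate : Fin n → Option (Fin n)
  left : Fin n → Fin n
  next : Fin n → Fin n

variable {n d : ℕ}

/-- The node `u` of `P` is matched. -/
def MState.Matched (M : MState n) (u : Fin n) : Prop := M.mate (M.left u) = some u

instance (M : MState n) : DecidablePred M.Matched := fun u =>
  inferInstanceAs (Decidable (M.mate (M.left u) = some u))

/-- The number of unmatched nodes of `P`. -/
def MState.deficit (M : MState n) : ℕ := (Finset.univ.filter fun u => ¬ M.Matched u).card

/-- `M` is a matching by edges of the graph with adjacency arrays `L`. -/
def MState.Valid (L : Fin n → Fin d → Fin n) (M : MState n) : Prop :=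
  ∀ u v, M.mate v = some u → M.left u = v ∧ ∃ i, L u i = v

theorem MState.Valid.matched_iff {L : Fin n → Fin d → Fin n} {M : MState n} (hM : M.Valid L)
    (u : Fin n) : M.Matched u ↔ ∃ v, M.mate v = some u :=
  ⟨fun h => ⟨_, h⟩, fun ⟨v, hv⟩ => by
    have := (hM u v hv).1
    unfold MState.Matched
    rw [this, hv]⟩

/-- Match `u` to `next u`. -/
def MState.rematch (M : MState n) (u : Fin n) : MState n where
  mate := Function.update M.mate (M.next u) (some u)
  left := Function.update M.left u (M.next u)
  next := M.next

/-- Augment from `u` along the pointers `next`. -/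
def MState.augment : ℕ → MState n → Fin n → MState n
  | 0, M, _ => M
  | f + 1, M, u => (M.mate (M.next u)).elim (M.rematch u) fun u' => (M.rematch u).augment f u'

theorem MState.Valid.rematch {L : Fin n → Fin d → Fin n} {M : MState n} (hM : M.Valid L)
    {u : Fin n} (hu : ¬ M.Matched u) (hadj : ∃ i, L u i = M.next u) : (M.rematch u).Valid L := by
  intro x v h
  rw [hM.matched_iff] at hu
  simp only [MState.rematch, Function.update_apply] at h ⊢
  split_ifs at h with hv
  · cases h
    simpa [hv] using hadj
  · have hx : x ≠ u := by rintro rfl; exact hu ⟨v, h⟩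
    simpa [hx] using hM x v h

/-- Only the mate of `next u` changes. A node `z` pointing there had its pointer lead to `w`, so its
rank is below that of `w` and it is outside the range that still matters. -/
theorem MState.rank_rematch {L : Fin n → Fin d → Fin n} {rank : Fin n → ℕ} {M : MState n}
    {u w : Fin n} (hr : ∀ z, rank u ≤ rank z → (∃ i, L z i = M.next z) ∧
      ∀ y, M.mate (M.next z) = some y → rank z < rank y) (hm : M.mate (M.next u) = some w) :
    ∀ z, rank w ≤ rank z → (∃ i, L z i = (M.rematch u).next z) ∧
      ∀ y, (M.rematch u).mate ((M.rematch u).next z) = some y → rank z < rank y := by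
  intro z hz
  have hrw := (hr u le_rfl).2 w hm
  obtain ⟨h3, h4⟩ := hr z (by omega)
  refine ⟨h3, fun y hy => ?_⟩
  simp only [MState.rematch, Function.update_apply] at hy
  split_ifs at hy with h
  · rw [h] at h4
    have := h4 w hm
    omega
  · exact h4 y hy

/-- The rank grows strictly along the pointers, so the path is simple and ends within the fuel `f`.
Pointers of nodes ranked below `u` may be left over from earlier walks; they are never followed. -/
theorem MState.augment_spec {L : Fin n → Fin d → Fin n} (rank : Fin n → ℕ) (b : ℕ)
    (hb : ∀ z, rank z ≤ b) (f : ℕ) : ∀ (M : MState n) (u : Fin n), M.Valid L → ¬ M.Matched u →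
      (∀ z, rank u ≤ rank z → (∃ i, L z i = M.next z) ∧
        ∀ y, M.mate (M.next z) = some y → rank z < rank y) → b < rank u + f →
      (M.augment f u).Valid L ∧ ∀ x, (M.augment f u).Matched x ↔ M.Matched x ∨ x = u := by
  induction f with
  | zero => intro M u _ _ _ h; have := hb u; omega
  | succ f ih =>
    intro M u hM hu hr hf
    have hV := hM.rematch hu (hr u le_rfl).1
    have hu' := hu
    rw [hM.matched_iff] at hu'
    rw [MState.augment]
    cases hm : M.mate (M.next u) with
    | none =>
      refine ⟨hV, fun x => ?_⟩
      simp only [Option.elim]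
      rw [hV.matched_iff, hM.matched_iff]
      simp only [MState.rematch, Function.update_apply]
      constructor
      · rintro ⟨v, hv⟩
        split_ifs at hv with h
        · cases hv; exact .inr rfl
        · exact .inl ⟨v, hv⟩
      · rintro (⟨v, hv⟩ | rfl)
        · have : v ≠ M.next u := by rintro rfl; simp [hm] at hv
          exact ⟨v, by simp [this, hv]⟩
        · exact ⟨M.next x, by simp⟩
    | some w =>
      simp only [Option.elim]
      have hw : w ≠ u := by rintro rfl; exact hu' ⟨_, hm⟩
      have hrw := (hr u le_rfl).2 w hm
      -- Rematching gains `u` and evicts `w`, which the recursive call then matches again.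
      have key : ∀ x, (M.rematch u).Matched x ↔ (M.Matched x ∧ x ≠ w) ∨ x = u := by
        intro x
        rw [hV.matched_iff, hM.matched_iff]
        simp only [MState.rematch, Function.update_apply]
        constructor
        · rintro ⟨v, hv⟩
          split_ifs at hv with h
          · cases hv; exact .inr rfl
          · refine .inl ⟨⟨v, hv⟩, ?_⟩
            rintro rfl
            exact h ((hM x v hv).1.symm.trans (hM x _ hm).1)
        · rintro (⟨⟨v, hv⟩, hx⟩ | rfl)
          · have : v ≠ M.next u := by rintro rfl; simp [hm] at hv; exact hx hv.symm
            exact ⟨v, by simp [this, hv]⟩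
          · exact ⟨M.next x, by simp⟩
      obtain ⟨h1, h2⟩ := ih (M.rematch u) w hV (by rw [key]; simp [hw])
        (MState.rank_rematch hr hm) (by omega)
      refine ⟨h1, fun x => ?_⟩
      rw [h2, key]
      have hwm : M.Matched w := (hM.matched_iff w).2 ⟨_, hm⟩
      by_cases hxw : x = w
      · subst hxw; simp [hwm]
      · simp [hxw]

/-! ### Walks and the order of their last exits. -/

section Walk

variable (L : Fin n → Fin d → Fin n) (mate : Fin n → Option (Fin n))

/-- The number of steps of the walk from `u` along the edges `e`, until a free node of `Q`. -/
def walkLen : (B : ℕ) → (Fin B → Fin d) → Fin n → ℕ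
  | 0, _, _ => 0
  | B + 1, e, u => 1 + (mate (L u (e 0))).elim 0 fun u' => walkLen B (Fin.tail e) u'

/-- Whether the walk from `u` along the edges `e` reaches a free node of `Q`. -/
def walkHit : (B : ℕ) → (Fin B → Fin d) → Fin n → Bool
  | 0, _, _ => false
  | B + 1, e, u => (mate (L u (e 0))).elim true fun u' => walkHit B (Fin.tail e) u'

/-- The pointers to the last exits after the walk. -/
def walkNext : (B : ℕ) → (Fin B → Fin d) → Fin n → (Fin n → Fin n) → Fin n → Fin n
  | 0, _, _, next => next
  | B + 1, e, u, next => (mate (L u (e 0))).elim (Function.update next u (L u (e 0)))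
      fun u' => walkNext B (Fin.tail e) u' (Function.update next u (L u (e 0)))

variable {L mate}

theorem walkLen_le_of_not_hit {B : ℕ} {e : Fin B → Fin d} {u : Fin n}
    (h : walkHit L mate B e u = false) : B ≤ walkLen L mate B e u := by
  induction B generalizing u with
  | zero => simp
  | succ B ih =>
    rw [walkHit] at h
    rw [walkLen]
    cases hm : mate (L u (e 0)) with
    | none => simp [hm] at h
    | some w =>
      rw [hm] at h
      have := ih h
      simp only [Option.elim]
      omega

/-- The last exit times of a walk rank the nodes that it visits. -/
theorem exists_rank_of_walkHit {B : ℕ} : ∀ (e : Fin B → Fin d) (u : Fin n) (next : Fin n → Fin n)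
    (rank : Fin n → ℕ) (j : ℕ), (∀ z, rank z ≤ j) →
    (∀ z, 1 ≤ rank z → (∃ i, L z i = next z) ∧
      ∀ y, mate (next z) = some y → y = u ∨ rank z < rank y) →
    walkHit L mate B e u = true →
    ∃ rank' : Fin n → ℕ, (∀ z, rank' z ≤ j + walkLen L mate B e u) ∧ (∀ z, rank z ≤ rank' z) ∧
      1 ≤ rank' u ∧ ∀ z, 1 ≤ rank' z → (∃ i, L z i = walkNext L mate B e u next z) ∧
        ∀ y, mate (walkNext L mate B e u next z) = some y → rank' z < rank' y := by
  induction B with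
  | zero => intro e u next rank j _ _ h; simp [walkHit] at h
  | succ B ih =>
    intro e u next rank j hj hr hhit
    -- The current node `u` is left at time `j + 1`, after all earlier exits, so its new rank
    -- exceeds all others. This settles the alternative `y = u` of the hypothesis, which covers
    -- pointers into a node that is yet to be left.
    have hle : ∀ z, rank z ≤ Function.update rank u (j + 1) z := by
      intro z
      have := hj z
      simp only [Function.update_apply]
      split_ifs <;> omega
    rw [walkHit] at hhit
    rw [walkLen, walkNext]
    cases hm : mate (L u (e 0)) with
    | none =>
      refine ⟨Function.update rank u (j + 1), fun z => ?_, hle, by simp, fun z hz => ?_⟩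
      · have := hj z
        simp only [Function.update_apply, Option.elim]
        split_ifs <;> omega
      · by_cases hzu : z = u
        · subst hzu
          simp [hm]
        · simp only [Option.elim, ne_eq, hzu, not_false_eq_true, Function.update_of_ne] at hz ⊢
          refine ⟨(hr z hz).1, fun y hy => ?_⟩
          rcases (hr z hz).2 y hy with rfl | h
          · have := hj z
            simp; omega
          · exact h.trans_le (hle y)
    | some w =>
      rw [hm] at hhit
      obtain ⟨r, h1, h2, h3, h4⟩ := ih (Fin.tail e) w (Function.update next u (L u (e 0)))
        (Function.update rank u (j + 1)) (j + 1)
        (fun z => by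
          have := hj z
          simp only [Function.update_apply]
          split_ifs <;> omega)
        (fun z hz => by
          by_cases hzu : z = u
          · subst hzu
            simp [hm, eq_comm]
          · simp only [ne_eq, hzu, not_false_eq_true, Function.update_of_ne] at hz ⊢
            refine ⟨(hr z hz).1, fun y hy => ?_⟩
            rcases (hr z hz).2 y hy with rfl | h
            · have := hj z
              right
              simp; omega
            · exact .inr (h.trans_le (hle y))) hhit
      refine ⟨r, fun z => ?_, fun z => (hle z).trans (h2 z), ?_, h4⟩
      · have := h1 z
        simp only [Option.elim]
        omega
      · have := h2 u
        simp at this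
        omega

end Walk

/-! ### One round: a walk from a given node, followed by augmentation if it succeeds -/

section Round

variable (L : Fin n → Fin d → Fin n) {B : ℕ}

/-- The pointers after a walk from `s` along `e`. -/
def MState.afterWalk (M : MState n) (s : Fin n) (e : Fin B → Fin d) : MState n :=
  { M with next := walkNext L M.mate B e s M.next }

/-- The effect of a round. -/
def MState.round (M : MState n) (y : Fin n × (Fin B → Fin d)) : MState n :=
  if M.Matched y.1 then M
  else if walkHit L M.mate B y.2 y.1 then
    (M.afterWalk L y.1 y.2).augment (walkLen L M.mate B y.2 y.1) y.1
  else M.afterWalk L y.1 y.2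

/-- The cost of a round. -/
def MState.roundCost (M : MState n) (y : Fin n × (Fin B → Fin d)) : ℕ :=
  if M.Matched y.1 then 1 else 1 + walkLen L M.mate B y.2 y.1

variable {L}

/-- Last exit times are bounded by the length of the walk, so that length is enough fuel for the
augmentation. Rank 0 marks nodes not visited by this walk. -/
theorem MState.Valid.augment_afterWalk {M : MState n} (hM : M.Valid L) {s : Fin n}
    {e : Fin B → Fin d} (hs : ¬ M.Matched s) (hhit : walkHit L M.mate B e s = true) :
    ((M.afterWalk L s e).augment (walkLen L M.mate B e s) s).Valid L ∧
    ∀ x, ((M.afterWalk L s e).augment (walkLen L M.mate B e s) s).Matched x ↔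
      M.Matched x ∨ x = s := by
  obtain ⟨r, h1, _, h3, h4⟩ := exists_rank_of_walkHit e s M.next (fun _ => 0) 0 (by simp)
    (by simp) hhit
  exact MState.augment_spec r (walkLen L M.mate B e s) (by simpa using h1) _ (M.afterWalk L s e) s
    hM hs (fun z hz => h4 z (h3.trans hz)) (by omega)

theorem MState.Valid.round {M : MState n} (hM : M.Valid L) (y : Fin n × (Fin B → Fin d)) :
    (M.round L y).Valid L := by
  unfold MState.round
  split_ifs with h1 h2
  · exact hM
  · exact (hM.augment_afterWalk h1 h2).1
  · exact hM

theorem MState.Valid.deficit_round_of_hit {M : MState n} (hM : M.Valid L)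
    {y : Fin n × (Fin B → Fin d)} (h1 : ¬ M.Matched y.1)
    (h2 : walkHit L M.mate B y.2 y.1 = true) : (M.round L y).deficit + 1 = M.deficit := by
  have key := (hM.augment_afterWalk h1 h2).2
  have : (M.round L y).deficit
      = ((Finset.univ.filter fun u => ¬ M.Matched u).erase y.1).card := by
    unfold MState.round MState.deficit
    rw [if_neg h1, if_pos h2]
    congr 1
    ext x
    simp only [Finset.mem_filter, Finset.mem_univ, true_and, Finset.mem_erase, key]
    tauto
  rw [this]
  exact Finset.card_erase_add_one (by simpa using h1)

theorem MState.deficit_round_of_not {M : MState n}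
    {y : Fin n × (Fin B → Fin d)} (h : M.Matched y.1 ∨ walkHit L M.mate B y.2 y.1 = false) :
    (M.round L y).deficit = M.deficit := by
  unfold MState.round
  split_ifs with h1 h2
  · rfl
  · simp_all
  · rfl

/-- Summation over edge sequences splits off the first edge. -/
theorem sum_cons {α β : Type*} [Fintype α] [AddCommMonoid β] (B : ℕ)
    (f : (Fin (B + 1) → α) → β) :
    ∑ e, f e = ∑ i : α, ∑ e : Fin B → α, f (Fin.cons i e) := by
  rw [← Fintype.sum_prod_type', ← (Fin.consEquiv fun _ : Fin (B + 1) => α).sum_comp]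
  rfl

/-- The total length of the walks from `u`. -/
def walkSum (L : Fin n → Fin d → Fin n) (mate : Fin n → Option (Fin n)) (B : ℕ) (u : Fin n) : ℕ :=
  ∑ e : Fin B → Fin d, walkLen L mate B e u

theorem walkSum_succ (mate : Fin n → Option (Fin n)) (B : ℕ) (u : Fin n) :
    walkSum L mate (B + 1) u
      = d ^ (B + 1) + ∑ i : Fin d, (mate (L u i)).elim 0 (walkSum L mate B) := by
  unfold walkSum
  rw [sum_cons]
  have : ∀ i : Fin d, ∑ e : Fin B → Fin d, walkLen L mate (B + 1) (Fin.cons i e) u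
      = d ^ B + (mate (L u i)).elim 0 (walkSum L mate B) := by
    intro i
    simp only [walkLen, Fin.cons_zero, Fin.tail_cons, Finset.sum_add_distrib]
    congr 1
    · simp
    · cases mate (L u i) <;> simp [walkSum]
  unfold walkSum at this
  simp only [this, Finset.sum_add_distrib]
  simp [pow_succ, mul_comm]

/-- A sequence of `B` edges has `d` extensions by a last edge, and none of them shortens the walk.
-/
theorem walkSum_mono (mate : Fin n → Option (Fin n)) (B : ℕ) (u : Fin n) :
    d * walkSum L mate B u ≤ walkSum L mate (B + 1) u := by
  induction B generalizing u with
  | zero => simp [walkSum, walkLen]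
  | succ B ih =>
    rw [walkSum_succ, walkSum_succ, mul_add, Finset.mul_sum]
    refine add_le_add (le_of_eq (by ring)) (Finset.sum_le_sum fun i _ => ?_)
    cases mate (L u i) with
    | none => simp
    | some w => simpa using ih w

/-- Every node of `Q` occurs exactly `d` times in the arrays of `P`. -/
def Regular (L : Fin n → Fin d → Fin n) : Prop :=
  ∀ v, (Finset.univ.filter fun x : Fin n × Fin d => L x.1 x.2 = v).card = d

/-- A uniform node of `P` followed by a uniform entry of its array is a uniform node of `Q`. This
invariance is where regularity enters. -/
theorem Regular.sum_eq (hL : Regular L) (f : Fin n → ℕ) :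
    ∑ u, ∑ i, f (L u i) = d * ∑ v, f v := by
  rw [← Fintype.sum_prod_type', ← Finset.sum_fiberwise (s := Finset.univ)
    (g := fun x : Fin n × Fin d => L x.1 x.2), Finset.mul_sum]
  refine Finset.sum_congr rfl fun v _ => ?_
  rw [Finset.sum_congr rfl (g := fun _ => f v) (fun x hx => by
    rw [(Finset.mem_filter.1 hx).2])]
  rw [Finset.sum_const, hL v, smul_eq_mul]

theorem MState.Valid.sum_mate {M : MState n} (hM : M.Valid L) (f : Fin n → ℕ) :
    ∑ v, (M.mate v).elim 0 f = ∑ u ∈ Finset.univ.filter M.Matched, f u := by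
  rw [← Finset.sum_filter_add_sum_filter_not Finset.univ (fun v => (M.mate v).isSome)]
  rw [Finset.sum_eq_zero (s := Finset.univ.filter fun v => ¬ (M.mate v).isSome = true), add_zero]
  · symm
    refine Finset.sum_bij (fun u _ => M.left u) ?_ ?_ ?_ ?_
    · intro u hu
      have hu : M.mate (M.left u) = some u := (Finset.mem_filter.1 hu).2
      simp [hu]
    · intro u hu u' hu' h
      have hu : M.mate (M.left u) = some u := (Finset.mem_filter.1 hu).2
      have hu' : M.mate (M.left u') = some u' := (Finset.mem_filter.1 hu').2
      rw [h, hu'] at hu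
      exact (Option.some.inj hu).symm
    · intro v hv
      obtain ⟨u, hu⟩ := Option.isSome_iff_exists.1 (Finset.mem_filter.1 hv).2
      exact ⟨u, by simpa using (hM.matched_iff u).2 ⟨v, hu⟩, (hM u v hu).1⟩
    · intro u hu
      have hu : M.mate (M.left u) = some u := (Finset.mem_filter.1 hu).2
      simp [hu]
  · intro v hv
    have : M.mate v = none := by simpa using hv
    simp [this]

/-- The total length of the walks from all unmatched nodes (Kac's bound on return times). -/
theorem sum_walkSum_le (hL : Regular L) {M : MState n} (hM : M.Valid L) (hd : 0 < d) (B : ℕ) :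
    ∑ u ∈ Finset.univ.filter (fun u => ¬ M.Matched u), walkSum L M.mate B u ≤ n * d ^ B := by
  have h1 : ∑ u, walkSum L M.mate (B + 1) u
      = n * d ^ (B + 1) + d * ∑ u ∈ Finset.univ.filter M.Matched, walkSum L M.mate B u := by
    simp only [walkSum_succ, Finset.sum_add_distrib]
    rw [hL.sum_eq (fun v => (M.mate v).elim 0 (walkSum L M.mate B)), hM.sum_mate]
    simp
  have h2 : d * ∑ u, walkSum L M.mate B u ≤ ∑ u, walkSum L M.mate (B + 1) u := by
    rw [Finset.mul_sum]
    exact Finset.sum_le_sum fun u _ => walkSum_mono _ _ _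
  have h4 : ∑ u ∈ Finset.univ.filter M.Matched, walkSum L M.mate B u
      + ∑ u ∈ Finset.univ.filter (fun u => ¬ M.Matched u), walkSum L M.mate B u
      = ∑ u, walkSum L M.mate B u := Finset.sum_filter_add_sum_filter_not _ _ _
  -- The sum over matched nodes appears with factor `d` on both sides and cancels, leaving the
  -- unmatched ones.
  rw [h1, ← h4, mul_add] at h2
  have h3 : d * ∑ u ∈ Finset.univ.filter (fun u => ¬ M.Matched u), walkSum L M.mate B u
      ≤ d * (n * d ^ B) := by
    have : d * (n * d ^ B) = n * d ^ (B + 1) := by ring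
    omega
  exact Nat.le_of_mul_le_mul_left h3 hd

/-- One unit pays for looking at the drawn node; Kac's bound, averaged over the `n` starts, gives
the other. -/
theorem sum_roundCost_le (hL : Regular L) {M : MState n} (hM : M.Valid L) (hd : 0 < d) :
    ∑ y : Fin n × (Fin B → Fin d), M.roundCost L y
      ≤ 2 * Fintype.card (Fin n × (Fin B → Fin d)) := by
  have h : ∑ y : Fin n × (Fin B → Fin d), M.roundCost L y
      = n * d ^ B
        + ∑ u ∈ Finset.univ.filter (fun u => ¬ M.Matched u), walkSum L M.mate B u := by
    rw [Fintype.sum_prod_type, Finset.sum_filter]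
    have : ∀ u, ∑ e : Fin B → Fin d, M.roundCost L (u, e)
        = d ^ B + if ¬ M.Matched u then walkSum L M.mate B u else 0 := by
      intro u
      simp only [MState.roundCost]
      by_cases hu : M.Matched u
      · simp [hu]
      · simp [hu, Finset.sum_add_distrib, walkSum]
    simp [this, Finset.sum_add_distrib]
  have := sum_walkSum_le hL hM hd B
  rw [h]
  simp
  omega

/-- Markov's inequality: an unsuccessful walk uses up the whole budget `B`, and the total length of
walks from unmatched nodes is bounded. -/
theorem deficit_mul_card_le (hL : Regular L) {M : MState n} (hM : M.Valid L) (hd : 0 < d)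
    (hn : 0 < n) (hB : B = 2 * n) :
    M.deficit * Fintype.card (Fin n × (Fin B → Fin d)) ≤ 2 * n *
      (Finset.univ.filter fun y : Fin n × (Fin B → Fin d) =>
        (M.round L y).deficit + 1 = M.deficit).card := by
  set U := Finset.univ.filter fun u => ¬ M.Matched u with hU
  by_cases hm : M.deficit = 0
  · simp [hm]
  have h1 : ∑ u ∈ U, (Finset.univ.filter fun e : Fin B → Fin d =>
      walkHit L M.mate B e u = true).card ≤ (Finset.univ.filter fun y : Fin n × (Fin B → Fin d) =>
        (M.round L y).deficit + 1 = M.deficit).card := by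
    rw [← Finset.card_sigma]
    refine Finset.card_le_card_of_injOn (fun x => (x.1, x.2)) ?_ ?_
    · rintro ⟨u, e⟩ hx
      simp only [Finset.coe_sigma, Set.mem_sigma_iff, Finset.mem_coe, Finset.mem_filter, hU,
        Finset.mem_univ, true_and] at hx
      simpa using hM.deficit_round_of_hit (y := (u, e)) hx.1 hx.2
    · rintro ⟨u, e⟩ _ ⟨u', e'⟩ _ h
      simpa using h
  have h2 : ∀ u, d ^ B = (Finset.univ.filter fun e : Fin B → Fin d =>
      walkHit L M.mate B e u = true).card + (Finset.univ.filter fun e : Fin B → Fin d =>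
      ¬ walkHit L M.mate B e u = true).card := by
    intro u
    rw [Finset.card_filter_add_card_filter_not]
    simp
  have h3 : ∀ u, (Finset.univ.filter fun e : Fin B → Fin d =>
      ¬ walkHit L M.mate B e u = true).card * B ≤ walkSum L M.mate B u := by
    intro u
    unfold walkSum
    rw [← smul_eq_mul, ← Finset.sum_const]
    refine (Finset.sum_le_sum fun e he => ?_).trans
      (Finset.sum_le_sum_of_subset (Finset.filter_subset _ _))
    exact walkLen_le_of_not_hit (by simpa using he)
  have h4 : M.deficit * d ^ B = ∑ u ∈ U, (Finset.univ.filter fun e : Fin B → Fin d =>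
      walkHit L M.mate B e u = true).card + ∑ u ∈ U, (Finset.univ.filter fun e : Fin B → Fin d =>
      ¬ walkHit L M.mate B e u = true).card := by
    rw [← Finset.sum_add_distrib, ← Finset.sum_congr rfl (fun u _ => h2 u)]
    simp [MState.deficit, hU]
  have h5 := (Finset.sum_le_sum fun u (_ : u ∈ U) => h3 u).trans (sum_walkSum_le hL hM hd B)
  rw [← Finset.sum_mul] at h5
  have hm1 : 1 ≤ M.deficit := Nat.one_le_iff_ne_zero.2 hm
  have hD : d ^ B ≤ M.deficit * d ^ B := Nat.le_mul_of_pos_left _ hm1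
  generalize ∑ u ∈ U, (Finset.univ.filter fun e : Fin B → Fin d =>
      ¬ walkHit L M.mate B e u = true).card = fails at h4 h5
  -- The budget `2 * n` is chosen so that the failures from all starts together fill at most half of
  -- the walks of one start, hence at most half of the walks from the unmatched nodes.
  have h6 : fails * 2 ≤ d ^ B := by
    refine Nat.le_of_mul_le_mul_left ?_ hn
    calc n * (fails * 2) = fails * B := by rw [hB]; ring
      _ ≤ _ := h5
  have h7 : M.deficit * d ^ B ≤ 2 * (Finset.univ.filter fun y : Fin n × (Fin B → Fin d) =>
        (M.round L y).deficit + 1 = M.deficit).card := by omega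
  have h8 := Nat.mul_le_mul_left n h7
  simp only [Fintype.card_prod, Fintype.card_fin, Fintype.card_fun]
  calc _ = n * (M.deficit * d ^ B) := by ring
    _ ≤ _ := h8
    _ = _ := by ring

end Round

/-! ### Sequences of independent rounds -/

section Rounds

variable {S Y : Type*} (step : S → Y → S) (cost : S → Y → ℕ) (m : S → ℕ)

/-- The cost of at most `T` rounds, which end when `m` vanishes. -/
def runCost : (T : ℕ) → (Fin T → Y) → S → ℕ
  | 0, _, _ => 0
  | T + 1, ω, s => if m s = 0 then 0 else cost s (ω 0) + runCost T (Fin.tail ω) (step s (ω 0))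

/-- The state after at most `T` rounds, which end when `m` vanishes. -/
def runEnd : (T : ℕ) → (Fin T → Y) → S → S
  | 0, _, s => s
  | T + 1, ω, s => if m s = 0 then s else runEnd T (Fin.tail ω) (step s (ω 0))

variable {step cost m}

theorem runEnd_of_eq_zero {T : ℕ} {ω : Fin T → Y} {s : S} (h : m s = 0) :
    runEnd step m T ω s = s := by
  cases T <;> simp [runEnd, h]

theorem runEnd_induction {P : S → Prop} (hP : ∀ s, P s → ∀ y, P (step s y)) {T : ℕ} :
    ∀ {ω : Fin T → Y} {s : S}, P s → P (runEnd step m T ω s) := by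
  induction T with
  | zero => intro ω s h; exact h
  | succ T ih =>
    intro ω s h
    rw [runEnd]
    split_ifs
    · exact h
    · exact ih (hP s h _)

variable [Fintype Y]

/-- If a round decreases `m` by one with probability at least `m / N`, and otherwise keeps it, then
the mean of a function of `m` after the round is bounded by a convex combination. -/
theorem sum_step_le {N : ℕ} (hN : 0 < N) {s : S}
    (hm : ∀ y, m (step s y) = m s ∨ m (step s y) + 1 = m s)
    (hsucc : m s * Fintype.card Y
      ≤ N * (Finset.univ.filter fun y => m (step s y) + 1 = m s).card)
    (f : ℕ → ℝ) (hf : f (m s - 1) ≤ f (m s)) :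
    ∑ y, f (m (step s y)) ≤
      Fintype.card Y * (f (m s) - m s / N * (f (m s) - f (m s - 1))) := by
  have h1 : ∑ y, f (m (step s y)) = Fintype.card Y * f (m s)
      - (Finset.univ.filter fun y => m (step s y) + 1 = m s).card * (f (m s) - f (m s - 1)) := by
    have : ∀ y, f (m (step s y)) = f (m s)
        - if m (step s y) + 1 = m s then f (m s) - f (m s - 1) else 0 := by
      intro y
      split_ifs with h
      · rw [← h]; simp
      · rw [(hm y).resolve_right h]; simp
    rw [Finset.sum_congr rfl fun y _ => this y, Finset.sum_sub_distrib, ← Finset.sum_filter]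
    simp [mul_sub]
  have h2 : (m s : ℝ) / N * Fintype.card Y
      ≤ (Finset.univ.filter fun y => m (step s y) + 1 = m s).card := by
    rw [div_mul_eq_mul_div, div_le_iff₀ (by positivity)]
    rw [mul_comm _ (N : ℝ)]
    exact_mod_cast hsucc
  rw [h1]
  nlinarith [mul_le_mul_of_nonneg_right h2 (sub_nonneg.2 hf)]

variable {P : S → Prop} {N : ℕ}

/-- The potential `c * N * harmonic m` falls by `c * N / m` with probability at least `m / N`, so on
average by at least the mean cost `c` of a round. -/
theorem sum_runCost_le (hN : 0 < N) (c : ℕ) (hP : ∀ s, P s → ∀ y, P (step s y))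
    (hm : ∀ s, P s → ∀ y, m (step s y) = m s ∨ m (step s y) + 1 = m s)
    (hsucc : ∀ s, P s → m s * Fintype.card Y
      ≤ N * (Finset.univ.filter fun y => m (step s y) + 1 = m s).card)
    (hcost : ∀ s, P s → ∑ y, cost s y ≤ c * Fintype.card Y) (T : ℕ) :
    ∀ s, P s → (∑ ω, runCost step cost m T ω s : ℝ)
      ≤ (Fintype.card Y : ℝ) ^ T * (c * N * harmonic (m s)) := by
  induction T with
  | zero => intro s _; simp [runCost, harmonic]; positivity
  | succ T ih =>
    intro s hs
    by_cases h0 : m s = 0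
    · simp [runCost, h0]
    have hN' : (0 : ℝ) < N := by exact_mod_cast hN
    have hms : (0 : ℝ) < m s := by exact_mod_cast Nat.pos_of_ne_zero h0
    rw [sum_cons]
    simp only [runCost, h0, if_false, Fin.cons_zero, Fin.tail_cons, Nat.cast_add,
      Finset.sum_add_distrib]
    have hH : (harmonic (m s) : ℝ) = harmonic (m s - 1) + (m s : ℝ)⁻¹ := by
      obtain ⟨k, hk⟩ := Nat.exists_eq_succ_of_ne_zero h0
      rw [hk, Nat.succ_eq_add_one, harmonic_succ]
      push_cast
      simp
    have h1 := sum_step_le hN (hm s hs) (hsucc s hs) (fun k => (c * N * harmonic k : ℝ)) (by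
      simp only [hH]
      gcongr
      simp)
    have h2 : ∑ y, ∑ ω : Fin T → Y, (runCost step cost m T ω (step s y) : ℝ)
        ≤ (Fintype.card Y : ℝ) ^ T * ∑ y, (c * N * harmonic (m (step s y)) : ℝ) := by
      rw [Finset.mul_sum]
      exact Finset.sum_le_sum fun y _ => ih _ (hP s hs y)
    have h3 : (m s : ℝ) / N * (c * N * harmonic (m s) - c * N * harmonic (m s - 1)) = c := by
      rw [hH]
      field_simp
      ring
    rw [h3] at h1
    have h4 : (∑ y, ∑ _ω : Fin T → Y, (cost s y : ℝ))
        ≤ (Fintype.card Y : ℝ) ^ T * (c * Fintype.card Y) := by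
      have : (∑ y, cost s y : ℝ) ≤ c * Fintype.card Y := by exact_mod_cast hcost s hs
      simp only [Finset.sum_const, Finset.card_univ, Fintype.card_fun, Fintype.card_fin, nsmul_eq_mul,
        ← Finset.mul_sum]
      push_cast
      gcongr
    have h5 := mul_le_mul_of_nonneg_left h1 (by positivity : (0:ℝ) ≤ (Fintype.card Y : ℝ) ^ T)
    calc _ ≤ _ := add_le_add h4 (h2.trans h5)
      _ = _ := by ring

/-- The potential `g` dominates the indicator of failure and at least halves at every success.
Success has probability at least `1 / N` while `m ≠ 0`, so its mean shrinks by `1 - 1 / (2 * N)` per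
round. -/
theorem card_runEnd_ne_zero_le (hN : 0 < N) (hP : ∀ s, P s → ∀ y, P (step s y))
    (hm : ∀ s, P s → ∀ y, m (step s y) = m s ∨ m (step s y) + 1 = m s)
    (hsucc : ∀ s, P s → m s * Fintype.card Y
      ≤ N * (Finset.univ.filter fun y => m (step s y) + 1 = m s).card) (T : ℕ) :
    ∀ s, P s → ((Finset.univ.filter fun ω => m (runEnd step m T ω s) ≠ 0).card : ℝ)
      ≤ (Fintype.card Y : ℝ) ^ T * (2 ^ m s * (1 - 1 / (2 * N)) ^ T) := by
  have hN' : (1 : ℝ) ≤ N := by exact_mod_cast hN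
  have hq : (0 : ℝ) ≤ 1 - 1 / (2 * N) := by
    rw [sub_nonneg, div_le_one (by positivity)]
    linarith
  set g : ℕ → ℝ := fun k => if k = 0 then 0 else 2 ^ k with hg
  suffices h : ∀ s, P s → ((Finset.univ.filter fun ω => m (runEnd step m T ω s) ≠ 0).card : ℝ)
      ≤ (Fintype.card Y : ℝ) ^ T * (g (m s) * (1 - 1 / (2 * N)) ^ T) by
    intro s hs
    refine (h s hs).trans ?_
    gcongr
    simp only [hg]
    split_ifs
    · positivity
    · exact le_rfl
  induction T with
  | zero =>
    intro s _
    by_cases h0 : m s = 0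
    · simp [runEnd, h0, hg]
    · simp [runEnd, h0, hg]
      exact one_le_pow₀ (by norm_num)
  | succ T ih =>
    intro s hs
    by_cases h0 : m s = 0
    · simp [runEnd, h0, hg]
    rw [Finset.card_filter]
    push_cast
    rw [sum_cons]
    simp only [runEnd, h0, if_false, Fin.cons_zero, Fin.tail_cons]
    have h1 := sum_step_le hN (hm s hs) (hsucc s hs) g (by
      simp only [hg, h0, if_false]
      split_ifs
      · positivity
      · exact pow_le_pow_right₀ (by norm_num) (by omega))
    have h2 : ∑ y, ∑ ω : Fin T → Y, (if m (runEnd step m T ω (step s y)) ≠ 0 then (1 : ℝ) else 0)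
        ≤ (Fintype.card Y : ℝ) ^ T * (1 - 1 / (2 * N)) ^ T * ∑ y, g (m (step s y)) := by
      rw [Finset.mul_sum]
      refine Finset.sum_le_sum fun y _ => ?_
      have := ih _ (hP s hs y)
      rw [Finset.card_filter] at this
      push_cast at this
      calc _ ≤ _ := this
        _ = _ := by ring
    have h3 : g (m s) - m s / N * (g (m s) - g (m s - 1)) ≤ g (m s) * (1 - 1 / (2 * N)) := by
      have hms : (1 : ℝ) ≤ m s := by exact_mod_cast Nat.one_le_iff_ne_zero.2 h0
      have hg1 : g (m s - 1) ≤ g (m s) / 2 := by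
        simp only [hg, h0, if_false]
        split_ifs
        · positivity
        · obtain ⟨k, hk⟩ := Nat.exists_eq_succ_of_ne_zero h0
          rw [hk, pow_succ]
          simp
      have hg0 : 0 ≤ g (m s) := by simp only [hg, h0, if_false]; positivity
      have : 1 / (N : ℝ) * (g (m s) / 2) ≤ m s / N * (g (m s) - g (m s - 1)) := by
        gcongr
        linarith
      have h6 : g (m s) * (1 - 1 / (2 * (N : ℝ))) = g (m s) - 1 / (N : ℝ) * (g (m s) / 2) := by
        field_simp
      linarith
    have h5 : (0:ℝ) ≤ (Fintype.card Y : ℝ) ^ T * (1 - 1 / (2 * N)) ^ T := by positivity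
    calc _ ≤ _ := h2
      _ ≤ _ := mul_le_mul_of_nonneg_left
        (h1.trans (mul_le_mul_of_nonneg_left h3 (by positivity))) h5
      _ = _ := by ring

end Rounds

/-! ### The program -/

/-- Straight-line code. -/
def block : Instr → List Instr → Prog
  | i, [] => .instr i
  | i, j :: l => .seq (.instr i) (block j l)

theorem exec_block {n : ℕ} (I : Input n) (w : ℕ) (tbl : List ℕ) (l : List Instr) :
    ∀ (i : Instr) (s : State),
      Exec I w tbl (block i l) s (l.length + 1) ((i :: l).foldl (fun s i => i.run I w tbl s) s) := by
  induction l with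
  | nil => intro i s; exact .instr i s
  | cons j l ih =>
    intro i s
    have := Exec.seq (.instr i s) (ih j (i.run I w tbl s))
    rw [add_comm] at this
    exact this

/-- A program that does nothing of interest. -/
def skipProg : Prog := .instr (.const 9 0)

/-- One step of the walk: the current node is `r14`, the address of the next table entry is `r11`,
the number of remaining steps is `r12`, and `r13` tells whether a free node was found. -/
def walkBody : Prog :=
  .seq (block (.const_table 15 11) [.bin .add 11 11 2, .probeLeft 7 14 15, .bin .add 8 1 14,
      .store 8 7, .bin .add 8 0 7, .load 9 8])
    (.ite 9 (block (.bin .sub 14 9 2) [.bin .sub 12 12 2]) (block (.const 12 0) [.const 13 1]))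

/-- One step of the augmentation; `r14` is the node of `P` to be matched. -/
def augmentBody : Prog :=
  block (.bin .add 8 1 14) [.load 7 8, .store 14 7, .bin .add 8 0 7, .load 16 8, .bin .add 9 14 2,
    .store 8 9, .bin .sub 14 16 2]

/-- The walk from the unmatched node `r6` and the augmentation; `r10` holds `0`. -/
def attempt : Prog :=
  .seq (block (.bin .add 14 6 10) [.bin .add 11 4 2, .bin .add 12 1 10, .const 13 0])
    (.seq (.while 12 walkBody)
      (.ite 13
        (.seq (block (.bin .add 14 6 10) [.const 16 1])
          (.seq (.while 16 augmentBody) (.instr (.bin .sub 5 5 2))))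
        skipProg))

/-- One round, with its table entries from the address `r4` on. -/
def roundBody : Prog :=
  .seq (block (.const_table 6 4) [.load 7 6, .bin .add 8 0 7, .load 9 8, .bin .add 10 6 2,
      .bin .eq 10 9 10])
    (.seq (.ite 10 skipProg attempt) (.instr (.bin .add 4 4 3)))

/-- The whole program. The register `r5` holds the number of unmatched nodes. -/
def matchingProg : Prog :=
  .seq (block (.size 0) [.bin .add 1 0 0, .const 2 1, .bin .add 3 1 2, .size 5, .degree 4,
      .bin .sub 4 4 2, .const 7 16, .bin .mul 7 7 0, .bin .mul 7 7 0, .bin .mul 7 7 0,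
      .bin .mul 7 7 0, .bin .mul 4 4 7, .bin .mul 4 4 3])
    (.while 5 roundBody)

/-- The encoding of an optional node as a word. -/
def encode {n : ℕ} : Option (Fin n) → ℕ
  | none => 0
  | some u => u + 1

/-- The machine state `s` represents `M` in its memory and has the constants in place. -/
structure Represents {n : ℕ} (M : MState n) (s : State) : Prop where
  r0 : s.reg 0 = n
  r1 : s.reg 1 = 2 * n
  r2 : s.reg 2 = 1
  r3 : s.reg 3 = 2 * n + 1
  left : ∀ u : Fin n, s.mem u = M.left u
  mate : ∀ v : Fin n, s.mem (n + v) = encode (M.mate v)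
  next : ∀ u : Fin n, s.mem (2 * n + u) = M.next u

/-! ### The machine simulates the abstract rounds. -/

section RAM

variable {n : ℕ} {I : Input n} {w : ℕ} {tbl : List ℕ}

/-- An iteration takes eight instructions and one test. -/
theorem exec_augment (hw : 4 * n + 4 ≤ 2 ^ w) (rank : Fin n → ℕ) (b : ℕ)
    (hb : ∀ z, rank z ≤ b) (f : ℕ) : ∀ (M : MState n) (u : Fin n) (s : State),
      (∀ z, rank u ≤ rank z → (∃ i, I.arrays.left z i = M.next z) ∧
        ∀ y, M.mate (M.next z) = some y → rank z < rank y) → b < rank u + f →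
      Represents M s → s.reg 14 = u → s.reg 16 ≠ 0 →
      ∃ s' t, Exec I w tbl (.while 16 augmentBody) s t s' ∧ t ≤ 9 * f + 1 ∧
        Represents (M.augment f u) s' ∧ ∀ r ≤ 6, s'.reg r = s.reg r := by
  induction f with
  | zero => intro M u _ _ h; have := hb u; omega
  | succ f ih =>
    intro M u s hr hf hs h14 h16
    have hu := u.isLt
    have hv := (M.next u).isLt
    have hstep := exec_block I w tbl [.load 7 8, .store 14 7, .bin .add 8 0 7, .load 16 8,
      .bin .add 9 14 2, .store 8 9, .bin .sub 14 16 2] (.bin .add 8 1 14) s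
    -- The store to the `left` area does not disturb the subsequent read from the `mate` area.
    have hmne : n + (M.next u : ℕ) ≠ u := by omega
    have hmate := hs.mate (M.next u)
    have henc : encode (M.mate (M.next u)) < 2 ^ w := by
      cases M.mate (M.next u) with
      | none => simp [encode]
      | some x => have := x.isLt; simp only [encode]; omega
    set s₁ := ([Instr.bin .add 8 1 14, .load 7 8, .store 14 7, .bin .add 8 0 7, .load 16 8,
      .bin .add 9 14 2, .store 8 9, .bin .sub 14 16 2]).foldl (fun s i => i.run I w tbl s) s with hs₁
    have hreg : ∀ r ≤ 6, s₁.reg r = s.reg r := by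
      intro r hr
      simp [hs₁, Instr.run, State.setReg, Function.update_apply]
      split_ifs <;> omega
    have hmem : s₁.mem = Function.update (Function.update s.mem u (M.next u)) (n + (M.next u : ℕ))
        (u + 1) := by
      simp (disch := omega) [hs₁, Instr.run, State.setReg, BinOp.eval, hs.r0,
        hs.r1, hs.r2, h14, hs.next, Nat.mod_eq_of_lt]
    have h16' : s₁.reg 16 = encode (M.mate (M.next u)) := by
      simp (disch := omega) [hs₁, Instr.run, State.setReg, BinOp.eval, hs.r0,
        hs.r1, hs.r2, h14, hs.next, Nat.mod_eq_of_lt, hmate]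
    have h14' : s₁.reg 14 = encode (M.mate (M.next u)) - 1 := by
      simp (disch := omega) [hs₁, Instr.run, State.setReg, BinOp.eval, hs.r0,
        hs.r1, hs.r2, h14, hs.next, Nat.mod_eq_of_lt, hmate]
    have hrep : Represents (M.rematch u) s₁ := by
      refine ⟨?_, ?_, ?_, ?_, fun x => ?_, fun x => ?_, fun x => ?_⟩
      · rw [hreg _ (by norm_num), hs.r0]
      · rw [hreg _ (by norm_num), hs.r1]
      · rw [hreg _ (by norm_num), hs.r2]
      · rw [hreg _ (by norm_num), hs.r3]
      · have := x.isLt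
        rw [hmem, Function.update_of_ne (by omega)]
        simp only [MState.rematch, Function.update_apply, Fin.val_inj, hs.left]
        split_ifs <;> rfl
      · have := x.isLt
        rw [hmem]
        simp only [MState.rematch, Function.update_apply, Nat.add_left_cancel_iff, Fin.val_inj,
          hs.mate]
        split_ifs <;> first | rfl | omega
      · have := x.isLt
        rw [hmem, Function.update_of_ne (by omega), Function.update_of_ne (by omega), hs.next]
        rfl
    rw [MState.augment]
    cases hm : M.mate (M.next u) with
    | none =>
      rw [hm] at h16'
      exact ⟨s₁, _, .while_true h16 hstep (.while_false h16'), by simp, hrep, hreg⟩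
    | some x =>
      rw [hm] at h16' h14'
      have hrw := (hr u le_rfl).2 x hm
      obtain ⟨s', t, h1, h2, h3, h4⟩ := ih (M.rematch u) x s₁ (MState.rank_rematch hr hm)
        (by omega) hrep (by simpa [encode] using h14') (by simp [h16', encode])
      refine ⟨s', _, .while_true h16 hstep h1, by simp; omega, h3, fun r hr => ?_⟩
      rw [h4 r hr, hreg r hr]

/-- An iteration takes nine instructions and two tests. Reaching a free node sets the remaining
budget to 0, which ends the loop. -/
theorem exec_walk (hw : 4 * n + 4 ≤ 2 ^ w) {B : ℕ} :
    ∀ (e : Fin B → Fin I.d) (M : MState n) (u : Fin n) (s : State) (q : ℕ),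
      Represents M s → s.reg 11 = q → q + B < 2 ^ w → s.reg 12 = B → B ≤ 2 * n → s.reg 13 = 0 →
      s.reg 14 = u → (∀ t : Fin B, tbl.getD (q + t) 0 = e t) → I.d ≤ n →
      ∃ s' t, Exec I w tbl (.while 12 walkBody) s t s' ∧
        t ≤ 11 * walkLen I.arrays.left M.mate B e u + 1 ∧
        Represents (M.afterWalk I.arrays.left u e) s' ∧
        (s'.reg 13 ≠ 0 ↔ walkHit I.arrays.left M.mate B e u = true) ∧
        ∀ r, r ≤ 6 ∨ r = 10 → s'.reg r = s.reg r := by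
  induction B with
  | zero =>
    intro e M u s q hs h11 hq h12 hB h13 h14 htbl hd
    exact ⟨s, 1, .while_false h12, by simp, hs, by simp [h13, walkHit], fun _ _ => rfl⟩
  | succ B ih =>
    intro e M u s q hs h11 hq h12 hB h13 h14 htbl hd
    have hu := u.isLt
    set v := I.arrays.left u (e 0) with hv
    have hvlt := v.isLt
    have he := (e 0).isLt
    have htbl0 : tbl[q]?.getD 0 = e 0 := by simpa using htbl 0
    have hentry : entry I.arrays.left u (e 0) = v := by simp [entry, hv]
    have hstep := exec_block I w tbl [.bin .add 11 11 2, .probeLeft 7 14 15, .bin .add 8 1 14,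
      .store 8 7, .bin .add 8 0 7, .load 9 8] (.const_table 15 11) s
    have henc : encode (M.mate v) < 2 ^ w := by
      cases M.mate v with
      | none => simp [encode]
      | some x => have := x.isLt; simp only [encode]; omega
    have hmate := hs.mate v
    set s₁ := ([Instr.const_table 15 11, .bin .add 11 11 2, .probeLeft 7 14 15, .bin .add 8 1 14,
      .store 8 7, .bin .add 8 0 7, .load 9 8]).foldl (fun s i => i.run I w tbl s) s with hs₁
    have hreg : ∀ r, r ≤ 6 ∨ r = 10 ∨ 12 ≤ r ∧ r ≤ 14 → s₁.reg r = s.reg r := by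
      intro r hr
      simp [hs₁, Instr.run, State.setReg, Function.update_apply]
      split_ifs <;> omega
    have hmem : s₁.mem = Function.update s.mem (2 * n + u) v := by
      simp (disch := omega) [hs₁, Instr.run, State.setReg, BinOp.eval, hs.r0,
        hs.r1, hs.r2, h14, h11, htbl0, hentry, Nat.mod_eq_of_lt]
    have h9 : s₁.reg 9 = encode (M.mate v) := by
      simp (disch := omega) [hs₁, Instr.run, State.setReg, BinOp.eval, hs.r0,
        hs.r1, hs.r2, h14, h11, htbl0, hentry, Nat.mod_eq_of_lt, hmate]
    have h11' : s₁.reg 11 = q + 1 := by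
      simp (disch := omega) [hs₁, Instr.run, State.setReg, Function.update_apply, BinOp.eval,
        hs.r2, h11, Nat.mod_eq_of_lt]
    have hrep : Represents { M with next := Function.update M.next u v } s₁ := by
      refine ⟨?_, ?_, ?_, ?_, fun x => ?_, fun x => ?_, fun x => ?_⟩
      · rw [hreg _ (by norm_num), hs.r0]
      · rw [hreg _ (by norm_num), hs.r1]
      · rw [hreg _ (by norm_num), hs.r2]
      · rw [hreg _ (by norm_num), hs.r3]
      · have := x.isLt
        rw [hmem, Function.update_of_ne (by omega), hs.left]
      · have := x.isLt
        rw [hmem, Function.update_of_ne (by omega), hs.mate]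
      · have := x.isLt
        rw [hmem]
        simp only [Function.update_apply, Nat.add_left_cancel_iff, Fin.val_inj, hs.next]
        split_ifs <;> rfl
    simp only [MState.afterWalk, walkLen, walkHit, walkNext]
    cases hm : M.mate v with
    | none =>
      rw [hm] at h9
      have hend := exec_block I w tbl [.const 13 1] (.const 12 0) s₁
      refine ⟨_, _, .while_true (by omega) (.seq hstep (.ite_false h9 hend)) (.while_false ?_),
        ?_, ⟨?_, ?_, ?_, ?_, ?_, ?_, ?_⟩, ?_, ?_⟩
      · simp [Instr.run, State.setReg]
      · simp
      · simpa [Instr.run, State.setReg, Function.update_apply] using hrep.r0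
      · simpa [Instr.run, State.setReg, Function.update_apply] using hrep.r1
      · simpa [Instr.run, State.setReg, Function.update_apply] using hrep.r2
      · simpa [Instr.run, State.setReg, Function.update_apply] using hrep.r3
      · simpa [Instr.run, State.setReg, Function.update_apply] using hrep.left
      · simpa [Instr.run, State.setReg, Function.update_apply] using hrep.mate
      · simpa [Instr.run, State.setReg, Function.update_apply] using hrep.next
      · simp (disch := omega) [Instr.run, State.setReg, Nat.mod_eq_of_lt]
      · intro r hr
        rw [← hreg r (by omega)]
        simp [Instr.run, State.setReg, Function.update_apply]
        split_ifs <;> omega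
    | some x =>
      rw [hm] at h9
      have hx := x.isLt
      have hend := exec_block I w tbl [.bin .sub 12 12 2] (.bin .sub 14 9 2) s₁
      set s₂ := ([Instr.bin .sub 14 9 2, .bin .sub 12 12 2]).foldl
        (fun s i => i.run I w tbl s) s₁ with hs₂
      have hreg₂ : ∀ r, r ≤ 11 ∨ r = 13 → s₂.reg r = s₁.reg r := by
        intro r hr
        simp [hs₂, Instr.run, State.setReg, Function.update_apply]
        split_ifs <;> omega
      have hmem₂ : s₂.mem = s₁.mem := rfl
      have h12' : s₂.reg 12 = B := by
        have := hreg 12 (by norm_num)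
        have h2 := hrep.r2
        simp (disch := omega) [hs₂, Instr.run, State.setReg, BinOp.eval,
          this, h12, h2, Nat.mod_eq_of_lt]
      have h14' : s₂.reg 14 = x := by
        have h2 := hrep.r2
        simp (disch := omega) [hs₂, Instr.run, State.setReg, BinOp.eval,
          h9, h2, Nat.mod_eq_of_lt, encode]
      have hrep₂ : Represents { M with next := Function.update M.next u v } s₂ := by
        refine ⟨?_, ?_, ?_, ?_, hrep.left, hrep.mate, hrep.next⟩
        · rw [hreg₂ _ (by norm_num), hrep.r0]
        · rw [hreg₂ _ (by norm_num), hrep.r1]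
        · rw [hreg₂ _ (by norm_num), hrep.r2]
        · rw [hreg₂ _ (by norm_num), hrep.r3]
      obtain ⟨s', t, h1, h2, h3, h4, h5⟩ := ih (Fin.tail e)
        { M with next := Function.update M.next u v } x s₂ (q + 1) hrep₂
        (by rw [hreg₂ _ (by norm_num), h11']) (by omega) h12' (by omega)
        (by rw [hreg₂ _ (by norm_num), hreg _ (by norm_num), h13]) h14'
        (fun t => by
          have := htbl t.succ
          rw [Fin.val_succ] at this
          rw [show q + 1 + (t : ℕ) = q + (t + 1) by ring, this]
          rfl) hd
      refine ⟨s', _, .while_true (by omega) (.seq hstep (.ite_true (by rw [h9]; simp [encode]) hend)) h1,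
        ?_, h3, h4, fun r hr => ?_⟩
      · simp only [List.length, Option.elim] at h2 ⊢
        omega
      · rw [h5 r hr, hreg₂ r (by omega), hreg r (by omega)]

theorem Represents.congr {M : MState n} {s s' : State} (hs : Represents M s)
    (hmem : s'.mem = s.mem) (hreg : ∀ r ≤ 3, s'.reg r = s.reg r) : Represents M s' where
  r0 := by rw [hreg _ (by norm_num), hs.r0]
  r1 := by rw [hreg _ (by norm_num), hs.r1]
  r2 := by rw [hreg _ (by norm_num), hs.r2]
  r3 := by rw [hreg _ (by norm_num), hs.r3]
  left := by rw [hmem]; exact hs.left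
  mate := by rw [hmem]; exact hs.mate
  next := by rw [hmem]; exact hs.next

/-- Walk and augmentation cost 11 and 9 per step of the walk, hence the factor 20. The summand 9
leaves room for the eight steps that `roundBody` adds. -/
theorem exec_attempt (hw : 4 * n + 4 ≤ 2 ^ w) (hd : I.d ≤ n) {M : MState n}
    (hM : M.Valid I.arrays.left) (y : Fin n × (Fin (2 * n) → Fin I.d)) {s : State} {p : ℕ}
    (hs : Represents M s) (h4 : s.reg 4 = p) (h5 : s.reg 5 = M.deficit) (h6 : s.reg 6 = y.1)
    (h10 : s.reg 10 = 0) (hp : p + (2 * n + 1) < 2 ^ w)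
    (htbl : ∀ t : Fin (2 * n), tbl.getD (p + 1 + t) 0 = y.2 t) (hy : ¬ M.Matched y.1) :
    ∃ s' t, Exec I w tbl attempt s t s' ∧ t + 9 ≤ 20 * M.roundCost I.arrays.left y ∧
      Represents (M.round I.arrays.left y) s' ∧ s'.reg 4 = p ∧
      s'.reg 5 = (M.round I.arrays.left y).deficit := by
  have hy1 := y.1.isLt
  have hblock := exec_block I w tbl [.bin .add 11 4 2, .bin .add 12 1 10, .const 13 0]
    (.bin .add 14 6 10) s
  set s₁ := ([Instr.bin .add 14 6 10, .bin .add 11 4 2, .bin .add 12 1 10, .const 13 0]).foldl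
    (fun s i => i.run I w tbl s) s with hs₁
  have hreg₁ : ∀ r ≤ 10, s₁.reg r = s.reg r := by
    intro r hr
    simp [hs₁, Instr.run, State.setReg, Function.update_apply]
    split_ifs <;> omega
  have hrep₁ : Represents M s₁ := hs.congr rfl fun r hr => hreg₁ r (by omega)
  obtain ⟨s₂, t₂, hwalk, ht₂, hrep₂, hhit, hreg₂⟩ := exec_walk hw y.2 M y.1 s₁ (p + 1) hrep₁
    (by simp (disch := omega) [hs₁, Instr.run, State.setReg, BinOp.eval, h4, hs.r2,
      Nat.mod_eq_of_lt])
    (by omega)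
    (by simp (disch := omega) [hs₁, Instr.run, State.setReg, BinOp.eval, h10, hs.r1,
      Nat.mod_eq_of_lt]) le_rfl
    (by simp [hs₁, Instr.run, State.setReg])
    (by simp (disch := omega) [hs₁, Instr.run, State.setReg, BinOp.eval, h10, h6,
      Nat.mod_eq_of_lt]) htbl hd
  have hreg : ∀ r, r ≤ 6 ∨ r = 10 → s₂.reg r = s.reg r := fun r hr => by
    rw [hreg₂ r hr, hreg₁ r (by omega)]
  have hcost : M.roundCost I.arrays.left y
      = 1 + walkLen I.arrays.left M.mate (2 * n) y.2 y.1 := by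
    rw [MState.roundCost, if_neg hy]
  by_cases hh : walkHit I.arrays.left M.mate (2 * n) y.2 y.1 = true
  · have hblock₂ := exec_block I w tbl [.const 16 1] (.bin .add 14 6 10) s₂
    set s₃ := ([Instr.bin .add 14 6 10, .const 16 1]).foldl
      (fun s i => i.run I w tbl s) s₂ with hs₃
    have hreg₃ : ∀ r ≤ 6, s₃.reg r = s₂.reg r := by
      intro r hr
      simp [hs₃, Instr.run, State.setReg, Function.update_apply]
      split_ifs <;> omega
    have hrep₃ := hrep₂.congr (s' := s₃) rfl fun r hr => hreg₃ r (by omega)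
    obtain ⟨rank, hb, _, hr1, hr2⟩ := exists_rank_of_walkHit y.2 y.1 M.next (fun _ => 0) 0
      (by simp) (by simp) hh
    obtain ⟨s₄, t₄, haug, ht₄, hrep₄, hreg₄⟩ := exec_augment (I := I) (tbl := tbl) hw rank
      (walkLen I.arrays.left M.mate (2 * n) y.2 y.1) (by simpa using hb)
      (walkLen I.arrays.left M.mate (2 * n) y.2 y.1) (M.afterWalk I.arrays.left y.1 y.2) y.1 s₃
      (fun z hz => hr2 z (hr1.trans hz)) (by omega) hrep₃
      (by simp (disch := omega) [hs₃, Instr.run, State.setReg, BinOp.eval, hreg, h10, h6,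
        Nat.mod_eq_of_lt])
      (by simp (disch := omega) [hs₃, Instr.run, State.setReg, Nat.mod_eq_of_lt])
    have hround : M.round I.arrays.left y = (M.afterWalk I.arrays.left y.1 y.2).augment
        (walkLen I.arrays.left M.mate (2 * n) y.2 y.1) y.1 := by
      rw [MState.round, if_neg hy, if_pos hh]
    have hdef := hM.deficit_round_of_hit (y := y) hy hh
    have hdle : M.deficit ≤ n := (Finset.card_le_univ _).trans (by simp)
    refine ⟨_, _, .seq hblock (.seq hwalk (.ite_true (hhit.2 hh)
      (.seq hblock₂ (.seq haug (.instr _ _))))), ?_, ?_, ?_, ?_⟩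
    · rw [hcost]; simp only [List.length]; omega
    · rw [hround]
      refine hrep₄.congr rfl fun r hr => ?_
      simp [Instr.run, State.setReg, Function.update_apply]
      omega
    · simp [Instr.run, State.setReg, hreg₄, hreg₃, hreg, h4]
    · simp (disch := omega) [Instr.run, State.setReg, BinOp.eval, hreg₄, hreg₃, hreg, h5, hs.r2,
        Nat.mod_eq_of_lt]
      omega
  · refine ⟨_, _, .seq hblock (.seq hwalk (.ite_false (by simpa [hh] using hhit)
      (.instr _ _))), ?_, ?_, ?_, ?_⟩
    · rw [hcost]; simp; omega
    · rw [MState.round, if_neg hy, if_neg hh]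
      refine hrep₂.congr rfl fun r hr => ?_
      simp [Instr.run, State.setReg, Function.update_apply]
      omega
    · simp [Instr.run, State.setReg, hreg, h4]
    · rw [MState.deficit_round_of_not (.inr (by simpa using hh))]
      simp [Instr.run, State.setReg, hreg, h5]

theorem exec_round (hw : 4 * n + 4 ≤ 2 ^ w) (hd : I.d ≤ n) {M : MState n}
    (hM : M.Valid I.arrays.left) (y : Fin n × (Fin (2 * n) → Fin I.d)) {s : State} {p : ℕ}
    (hs : Represents M s) (h4 : s.reg 4 = p) (h5 : s.reg 5 = M.deficit)
    (hp : p + (2 * n + 1) < 2 ^ w) (htbl0 : tbl.getD p 0 = y.1)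
    (htbl : ∀ t : Fin (2 * n), tbl.getD (p + 1 + t) 0 = y.2 t) :
    ∃ s' t, Exec I w tbl roundBody s t s' ∧ t ≤ 20 * M.roundCost I.arrays.left y ∧
      Represents (M.round I.arrays.left y) s' ∧ s'.reg 4 = p + (2 * n + 1) ∧
      s'.reg 5 = (M.round I.arrays.left y).deficit := by
  have hy1 := y.1.isLt
  have hl := (M.left y.1).isLt
  have htbl0' : tbl[p]?.getD 0 = y.1 := by simpa using htbl0
  have hmate := hs.mate (M.left y.1)
  have henc : encode (M.mate (M.left y.1)) < 2 ^ w := by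
    cases M.mate (M.left y.1) with
    | none => simp [encode]
    | some x => have := x.isLt; simp only [encode]; omega
  have hblock := exec_block I w tbl [.load 7 6, .bin .add 8 0 7, .load 9 8, .bin .add 10 6 2,
      .bin .eq 10 9 10] (.const_table 6 4) s
  set s₁ := ([Instr.const_table 6 4, .load 7 6, .bin .add 8 0 7, .load 9 8, .bin .add 10 6 2,
      .bin .eq 10 9 10]).foldl (fun s i => i.run I w tbl s) s with hs₁
  have hreg₁ : ∀ r ≤ 5, s₁.reg r = s.reg r := by
    intro r hr
    simp [hs₁, Instr.run, State.setReg, Function.update_apply]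
    split_ifs <;> omega
  have hrep₁ : Represents M s₁ := hs.congr rfl fun r hr => hreg₁ r (by omega)
  have h6 : s₁.reg 6 = y.1 := by
    simp (disch := omega) [hs₁, Instr.run, State.setReg, h4, htbl0', Nat.mod_eq_of_lt]
  -- The `left` entry of an unmatched node may be meaningless, so the program asks whether the mate
  -- of that entry points back.
  have h10 : s₁.reg 10 = if M.Matched y.1 then 1 else 0 := by
    have hiff : encode (M.mate (M.left y.1)) = y.1 + 1 ↔ M.Matched y.1 := by
      unfold MState.Matched
      cases M.mate (M.left y.1) with
      | none => simp [encode]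
      | some x => simp [encode, Fin.val_inj]
    simp (disch := omega) [hs₁, Instr.run, State.setReg, BinOp.eval, h4, htbl0', hs.r0,
      hs.r2, hs.left, hmate, Nat.mod_eq_of_lt, hiff]
    split_ifs
    · exact Nat.mod_eq_of_lt (by omega)
    · simp
  have hlast : ∀ (M' : MState n) (s' : State), Represents M' s' → s'.reg 4 = p →
      s'.reg 5 = M'.deficit →
      Represents M' (s'.setReg w 4 (s'.reg 4 + s'.reg 3)) ∧
      (s'.setReg w 4 (s'.reg 4 + s'.reg 3)).reg 4 = p + (2 * n + 1) ∧
      (s'.setReg w 4 (s'.reg 4 + s'.reg 3)).reg 5 = M'.deficit := by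
    intro M' s' hs' h4' h5'
    refine ⟨hs'.congr rfl fun r hr => ?_, ?_, ?_⟩
    · simp [State.setReg, Function.update_apply]; omega
    · simp (disch := omega) [State.setReg, h4', hs'.r3, Nat.mod_eq_of_lt]
    · simp [State.setReg, h5']
  by_cases hy : M.Matched y.1
  · rw [if_pos hy] at h10
    have hround : M.round I.arrays.left y = M := by rw [MState.round, if_pos hy]
    have := hlast M (s₁.setReg w 9 0) (hrep₁.congr rfl fun r hr => by
        simp [State.setReg, Function.update_apply]; omega)
      (by simp [State.setReg, hreg₁, h4]) (by simp [State.setReg, hreg₁, h5])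
    rw [hround]
    refine ⟨_, _, .seq hblock (.seq (.ite_true (by omega) (.instr _ _)) (.instr _ _)), ?_, this⟩
    rw [MState.roundCost, if_pos hy]
    simp
  · rw [if_neg hy] at h10
    obtain ⟨s₂, t, h, ht, hrep₂, h4₂, h5₂⟩ := exec_attempt hw hd hM y hrep₁
      ((hreg₁ 4 (by norm_num)).trans h4) ((hreg₁ 5 (by norm_num)).trans h5) h6 h10 hp htbl hy
    refine ⟨_, _, .seq hblock (.seq (.ite_false h10 h) (.instr _ _)), ?_,
      hlast _ s₂ hrep₂ h4₂ h5₂⟩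
    simp
    omega

/-- The loop test of each round is charged to the round, whose cost is at least 1; this turns 20
into 21. -/
theorem exec_rounds (hw : 4 * n + 4 ≤ 2 ^ w) (hd : I.d ≤ n) (T : ℕ) :
    ∀ (ω : Fin T → Fin n × (Fin (2 * n) → Fin I.d)) (M : MState n) (s : State) (p : ℕ),
      M.Valid I.arrays.left → Represents M s → s.reg 4 = p → s.reg 5 = M.deficit →
      p + T * (2 * n + 1) < 2 ^ w →
      (∀ r : Fin T, tbl.getD (p + r * (2 * n + 1)) 0 = (ω r).1) →
      (∀ (r : Fin T) (t : Fin (2 * n)),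
        tbl.getD (p + r * (2 * n + 1) + 1 + t) 0 = (ω r).2 t) →
      (runEnd (MState.round I.arrays.left) MState.deficit T ω M).deficit = 0 →
      ∃ s' t, Exec I w tbl (.while 5 roundBody) s t s' ∧
        t ≤ 21 * runCost (MState.round I.arrays.left) (MState.roundCost I.arrays.left)
          MState.deficit T ω M + 1 ∧
        Represents (runEnd (MState.round I.arrays.left) MState.deficit T ω M) s' := by
  induction T with
  | zero =>
    intro ω M s p _ hs _ h5 _ _ _ hend
    exact ⟨s, 1, .while_false (by rw [h5]; exact hend), by simp, hs⟩
  | succ T ih =>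
    intro ω M s p hM hs h4 h5 hp ht1 ht2 hend
    by_cases h0 : M.deficit = 0
    · rw [runEnd_of_eq_zero h0]
      exact ⟨s, 1, .while_false (by rw [h5, h0]), by simp, hs⟩
    rw [runEnd, if_neg h0] at hend ⊢
    rw [runCost, if_neg h0]
    have hTmul : (T + 1) * (2 * n + 1) = T * (2 * n + 1) + (2 * n + 1) := by ring
    obtain ⟨s₁, t₁, he₁, ht₁, hs₁, h4₁, h5₁⟩ := exec_round hw hd hM (ω 0) hs h4 h5 (by omega)
      (by simpa using ht1 0) (by simpa using ht2 0)
    obtain ⟨s₂, t₂, he₂, ht₂, hs₂⟩ := ih (Fin.tail ω) _ s₁ (p + (2 * n + 1)) (hM.round _) hs₁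
      h4₁ h5₁ (by omega)
      (fun r => by
        rw [show p + (2 * n + 1) + r * (2 * n + 1) = p + (r.succ : ℕ) * (2 * n + 1) by
          rw [Fin.val_succ]; ring, ht1]
        rfl)
      (fun r t => by
        rw [show p + (2 * n + 1) + r * (2 * n + 1) = p + (r.succ : ℕ) * (2 * n + 1) by
          rw [Fin.val_succ]; ring, ht2]
        rfl) hend
    have hc : 1 ≤ M.roundCost I.arrays.left (ω 0) := by
      rw [MState.roundCost]; split_ifs <;> omega
    refine ⟨s₂, _, .while_true (by rw [h5]; exact h0) he₁ he₂, ?_, hs₂⟩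
    omega

/-- The empty matching. -/
def emptyState (n : ℕ) [NeZero n] : MState n := ⟨fun _ => none, fun _ => 0, fun _ => 0⟩

theorem emptyState_valid [NeZero n] {d : ℕ} (L : Fin n → Fin d → Fin n) :
    (emptyState n).Valid L := by
  intro u v h
  simp [emptyState] at h

theorem emptyState_deficit [NeZero n] : (emptyState n).deficit = n := by
  simp [emptyState, MState.deficit, MState.Matched]

/-- The table has one segment of `T * (2 * n + 1)` words per degree. The 15 extra steps are the 14
initial instructions and the last loop test. -/
theorem exec_matchingProg [NeZero n] (hd : I.d ≤ n) {T : ℕ} (hT : T = 16 * n ^ 4)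
    (hw : 4 * n + 4 ≤ 2 ^ w) (hwT : n * T * (2 * n + 1) < 2 ^ w)
    (ω : Fin T → Fin n × (Fin (2 * n) → Fin I.d))
    (ht1 : ∀ r : Fin T, tbl.getD (((I.d - 1) * T + r) * (2 * n + 1)) 0 = (ω r).1)
    (ht2 : ∀ (r : Fin T) (t : Fin (2 * n)),
        tbl.getD (((I.d - 1) * T + r) * (2 * n + 1) + 1 + t) 0 = (ω r).2 t)
    (hend : (runEnd (MState.round I.arrays.left) MState.deficit T ω (emptyState n)).deficit = 0) :
    ∃ t, FindsPerfectMatchingIn I w tbl matchingProg t ∧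
      t ≤ 21 * runCost (MState.round I.arrays.left) (MState.roundCost I.arrays.left)
          MState.deficit T ω (emptyState n) + 15 := by
  have hn : 0 < n := Nat.pos_of_neZero n
  have hblock := exec_block I w tbl [.bin .add 1 0 0, .const 2 1, .bin .add 3 1 2, .size 5,
      .degree 4, .bin .sub 4 4 2, .const 7 16, .bin .mul 7 7 0, .bin .mul 7 7 0, .bin .mul 7 7 0,
      .bin .mul 7 7 0, .bin .mul 4 4 7, .bin .mul 4 4 3] (.size 0) State.init
  set s₁ := ([Instr.size 0, .bin .add 1 0 0, .const 2 1, .bin .add 3 1 2, .size 5,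
      .degree 4, .bin .sub 4 4 2, .const 7 16, .bin .mul 7 7 0, .bin .mul 7 7 0, .bin .mul 7 7 0,
      .bin .mul 7 7 0, .bin .mul 4 4 7, .bin .mul 4 4 3]).foldl
      (fun s i => i.run I w tbl s) State.init with hs₁
  -- The program builds `16 * n ^ 4` by repeated multiplication; no intermediate product may
  -- overflow a word.
  have hpow : ∀ k ≤ 4, 16 * n ^ k < 2 ^ w := by
    intro k hk
    refine lt_of_le_of_lt ?_ hwT
    have h1 : n ^ k ≤ n ^ 4 := Nat.pow_le_pow_right hn hk
    have h2 : 16 * n ^ 4 ≤ n * (16 * n ^ 4) * (2 * n + 1) := by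
      rw [mul_comm n, mul_assoc]
      exact Nat.le_mul_of_pos_right _ (by positivity)
    rw [hT]
    omega
  have hp0 := hpow 0 (by norm_num)
  have hp1 := hpow 1 (by norm_num)
  have hp2 := hpow 2 (by norm_num)
  have hp3 := hpow 3 (by norm_num)
  have hp4 := hpow 4 (by norm_num)
  have hI := I.d_pos
  have hD : (I.d - 1) * T * (2 * n + 1) + T * (2 * n + 1) ≤ n * T * (2 * n + 1) := by
    rw [← add_mul]
    refine Nat.mul_le_mul_right _ ?_
    calc (I.d - 1) * T + T = (I.d - 1 + 1) * T := by ring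
      _ ≤ n * T := Nat.mul_le_mul_right _ (by omega)
  have hD' : (I.d - 1) * T ≤ (I.d - 1) * T * (2 * n + 1) :=
    Nat.le_mul_of_pos_right _ (by positivity)
  have e2 : 16 * n * n = 16 * n ^ 2 := by ring
  have e3 : 16 * n ^ 2 * n = 16 * n ^ 3 := by ring
  have e4 : 16 * n ^ 3 * n = T := by rw [hT]; ring
  have h4 : s₁.reg 4 = (I.d - 1) * T * (2 * n + 1) := by
    have hTw : T < 2 ^ w := by rw [hT]; exact hp4
    simp (disch := omega) [hs₁, Instr.run, State.setReg, BinOp.eval, Nat.mod_eq_of_lt, e2, e3, e4,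
      ← two_mul]
  have h5 : s₁.reg 5 = n := by
    simp (disch := omega) [hs₁, Instr.run, State.setReg, Nat.mod_eq_of_lt]
  -- Since `none` is encoded as 0, the zero memory already represents the empty matching.
  have hrep : Represents (emptyState n) s₁ := by
    refine ⟨?_, ?_, ?_, ?_, fun _ => ?_, fun _ => ?_, fun _ => ?_⟩
    · simp (disch := omega) [hs₁, Instr.run, State.setReg, Nat.mod_eq_of_lt]
    · simp (disch := omega) [hs₁, Instr.run, State.setReg, BinOp.eval, Nat.mod_eq_of_lt, ← two_mul]
    · simp (disch := omega) [hs₁, Instr.run, State.setReg, Nat.mod_eq_of_lt]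
    · simp (disch := omega) [hs₁, Instr.run, State.setReg, BinOp.eval, Nat.mod_eq_of_lt, ← two_mul]
    · simp [hs₁, Instr.run, State.setReg, State.init, emptyState]
    · simp [hs₁, Instr.run, State.setReg, State.init, emptyState, encode]
    · simp [hs₁, Instr.run, State.setReg, State.init, emptyState]
  obtain ⟨s', t, h1, h2, h3⟩ := exec_rounds hw hd T ω (emptyState n) s₁ _
    (emptyState_valid _) hrep h4 (by rw [h5, emptyState_deficit]) (by omega)
    (fun r => by rw [← ht1 r, add_mul]) (fun r t => by rw [← ht2 r t, add_mul]) hend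
  set M := runEnd (MState.round I.arrays.left) MState.deficit T ω (emptyState n) with hM
  have hV : M.Valid I.arrays.left :=
    runEnd_induction (P := MState.Valid I.arrays.left) (fun s hs y => hs.round y)
      (emptyState_valid _)
  have hall : ∀ u, M.mate (M.left u) = some u := by
    intro u
    by_contra hu
    have : u ∈ Finset.univ.filter fun u => ¬ M.Matched u :=
      Finset.mem_filter.2 ⟨Finset.mem_univ u, hu⟩
    rw [Finset.card_eq_zero.1 hend] at this
    simp at this
  have hinj : Function.Injective M.left := by
    intro u u' h
    have := hall u
    rw [h, hall u'] at this
    exact (Option.some.inj this).symm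
  refine ⟨_, ⟨s', .seq hblock h1, Finset.univ.image fun u => (u, M.left u), ⟨?_, ?_, ?_⟩, ?_⟩, ?_⟩
  · intro e he
    obtain ⟨u, _, rfl⟩ := Finset.mem_image.1 he
    exact (I.arrays.left_spec _ _).2 (hV u _ (hall u)).2
  · intro u
    exact ⟨M.left u, by simp, by simp⟩
  · intro v
    obtain ⟨u, rfl⟩ := (Finite.injective_iff_surjective.1 hinj) v
    exact ⟨u, by simp, fun u' h => by simpa [hinj.eq_iff] using h⟩
  · intro e he
    obtain ⟨u, _, rfl⟩ := Finset.mem_image.1 he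
    exact h3.left u
  · simp only [List.length]
    omega

end RAM

/-! ### A table that is good for all inputs, and fast on average -/

theorem Input.regular {n : ℕ} (I : Input n) : Regular I.arrays.left := by
  intro v
  refine Eq.trans ?_ (I.graph.right_degree v)
  refine Finset.card_bij (fun x _ => x.1) ?_ ?_ ?_
  · intro x hx
    rw [Finset.mem_filter] at hx ⊢
    exact ⟨Finset.mem_univ _, (I.arrays.left_spec _ _).2 ⟨_, hx.2⟩⟩
  · rintro ⟨u, i⟩ hx ⟨u', i'⟩ hx' (rfl : u = u')
    rw [Finset.mem_filter] at hx hx'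
    exact congrArg (Prod.mk u) (I.arrays.left_injective u (hx.2.trans hx'.2.symm))
  · intro u hu
    rw [Finset.mem_filter] at hu
    obtain ⟨i, hi⟩ := (I.arrays.left_spec _ _).1 hu.2
    exact ⟨(u, i), by simpa using hi, rfl⟩

theorem Input.d_le {n : ℕ} [NeZero n] (I : Input n) : I.d ≤ n := by
  simpa using Fintype.card_le_of_injective _ (I.arrays.left_injective 0)

/-- The arrays of `P`, indexed by the successor of a number. -/
def Input.leftArrays {n : ℕ} (I : Input n) : Fin n → Fin (I.d - 1 + 1) → Fin n :=
  fun u i => I.arrays.left u (i.cast (Nat.sub_add_cancel I.d_pos))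

theorem Input.regular_leftArrays {n : ℕ} (I : Input n) : Regular I.leftArrays := by
  rcases I with ⟨d, hd, G, A⟩
  -- Once the degree is literally a successor, the cast in `leftArrays` disappears by definition.
  obtain ⟨e, rfl⟩ := Nat.exists_eq_succ_of_ne_zero (Nat.one_le_iff_ne_zero.1 hd)
  exact (Input.mk (e + 1) hd G A).regular

/-- The random choices of the algorithm, for every degree. -/
abbrev Choices (n T : ℕ) : Type := ∀ e : Fin n, Fin T → Fin n × (Fin (2 * n) → Fin (e + 1))

/-- An input of degree `e + 1` reads only the coordinate `e` of the choices; averages over one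
coordinate are averages over the product. -/
theorem sum_apply_le {ι : Type*} [Fintype ι] [DecidableEq ι] {X : ι → Type*}
    [∀ i, Fintype (X i)] (i : ι) (g : X i → ℝ) (c : ℝ) (h : ∑ x, g x ≤ Fintype.card (X i) * c) :
    ∑ ω : ∀ i, X i, g (ω i) ≤ Fintype.card (∀ i, X i) * c := by
  have h1 : ∑ ω : ∀ i, X i, g (ω i)
      = Fintype.card (∀ j : { j // j ≠ i }, X j) * ∑ x, g x := by
    rw [← (Equiv.piSplitAt i X).symm.sum_comp, Fintype.sum_prod_type]
    simp [Equiv.piSplitAt, Finset.mul_sum]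
  rw [h1, Fintype.card_congr (Equiv.piSplitAt i X), Fintype.card_prod]
  push_cast
  calc _ ≤ _ := mul_le_mul_of_nonneg_left h (by positivity)
    _ = _ := by ring

theorem MState.Valid.deficit_round {d B : ℕ} {L : Fin n → Fin d → Fin n} {M : MState n}
    (hM : M.Valid L) (y : Fin n × (Fin B → Fin d)) :
    (M.round L y).deficit = M.deficit ∨ (M.round L y).deficit + 1 = M.deficit := by
  by_cases h : M.Matched y.1 ∨ walkHit L M.mate B y.2 y.1 = false
  · exact .inl (MState.deficit_round_of_not h)
  · rw [not_or] at h
    exact .inr (hM.deficit_round_of_hit h.1 (by simpa using h.2))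

/-! ### Union bound over all inputs, and averaging over the choices. -/

section Average

variable {n T : ℕ} [NeZero n] {e : Fin n} {L : Fin n → Fin (e + 1) → Fin n}

/-- The cost of all rounds. -/
def totalCost (e : Fin n) (L : Fin n → Fin (e + 1) → Fin n) (ω : Choices n T) : ℕ :=
  runCost (MState.round L) (MState.roundCost L) MState.deficit T (ω e) (emptyState n)

/-- The number of unmatched nodes after all rounds. -/
def finalDeficit (e : Fin n) (L : Fin n → Fin (e + 1) → Fin n) (ω : Choices n T) : ℕ :=
  (runEnd (MState.round L) MState.deficit T (ω e) (emptyState n)).deficit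

theorem sum_totalCost_le (hL : Regular L) :
    ∑ ω : Choices n T, (totalCost e L ω : ℝ)
      ≤ Fintype.card (Choices n T) * (4 * n * harmonic n) := by
  refine sum_apply_le (X := fun e : Fin n => Fin T → Fin n × (Fin (2 * n) → Fin (e + 1))) e
    (fun ω => ((runCost (MState.round L) (MState.roundCost L) MState.deficit T
      ω (emptyState n) : ℕ) : ℝ)) _ ?_
  have := sum_runCost_le (P := MState.Valid L) (N := 2 * n) (step := MState.round L)
    (Y := Fin n × (Fin (2 * n) → Fin (e + 1)))
    (cost := MState.roundCost L) (m := MState.deficit) (by have := NeZero.pos n; omega) 2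
    (fun M hM y => hM.round y) (fun M hM y => hM.deficit_round y)
    (fun M hM => deficit_mul_card_le hL hM (Nat.succ_pos _) (NeZero.pos n) rfl)
    (fun M hM => sum_roundCost_le hL hM (Nat.succ_pos _)) T (emptyState n) (emptyState_valid L)
  rw [emptyState_deficit] at this
  refine this.trans (le_of_eq ?_)
  rw [Fintype.card_fun, Fintype.card_fin T]
  push_cast
  ring

theorem card_finalDeficit_le (hL : Regular L) :
    ((Finset.univ.filter fun ω : Choices n T => finalDeficit e L ω ≠ 0).card : ℝ)
      ≤ Fintype.card (Choices n T) * (2 ^ n * (1 - 1 / (4 * n)) ^ T) := by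
  rw [Finset.card_filter]
  push_cast
  refine sum_apply_le (X := fun e : Fin n => Fin T → Fin n × (Fin (2 * n) → Fin (e + 1))) e
    (fun ω => if (runEnd (MState.round L) MState.deficit T ω
    (emptyState n)).deficit ≠ 0 then (1 : ℝ) else 0) _ ?_
  have := card_runEnd_ne_zero_le (P := MState.Valid L) (N := 2 * n) (step := MState.round L)
    (Y := Fin n × (Fin (2 * n) → Fin (e + 1)))
    (m := MState.deficit) (by have := NeZero.pos n; omega)
    (fun M hM y => hM.round y) (fun M hM y => hM.deficit_round y)
    (fun M hM => deficit_mul_card_le hL hM (Nat.succ_pos _) (NeZero.pos n) rfl)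
    T (emptyState n) (emptyState_valid L)
  rw [emptyState_deficit, Finset.card_filter] at this
  push_cast at this
  refine this.trans (le_of_eq ?_)
  rw [Fintype.card_fun, Fintype.card_fin T]
  push_cast
  ring

/-- The choices for which the algorithm succeeds on all inputs. -/
def IsUniversal (ω : Choices n T) : Prop :=
  ∀ (e : Fin n) (L : Fin n → Fin (e + 1) → Fin n), Regular L → finalDeficit e L ω = 0

/-- The power is at most `exp (-4 n^3) ≤ 2^(-4 n^3)`, while the other factors are at most `2^(n^3 +
2n)`. The exponent `16 n^4` is chosen for this comparison. -/
theorem failure_bound (n : ℕ) (hn : 0 < n) :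
    (n : ℝ) * n ^ (n * n) * (2 ^ n * (1 - 1 / (4 * n)) ^ (16 * n ^ 4)) ≤ 1 / 2 := by
  have hn' : (0 : ℝ) < n := by exact_mod_cast hn
  have h1 : (n : ℝ) ≤ 2 ^ n := by exact_mod_cast Nat.lt_two_pow_self.le
  have h2 : (1 - 1 / (4 * n) : ℝ) ^ (16 * n ^ 4) ≤ (1 / 2) ^ (4 * n ^ 3) := by
    have h3 : (1 - 1 / (4 * n) : ℝ) ≤ Real.exp (-(1 / (4 * n))) := by
      have := Real.add_one_le_exp (-(1 / (4 * n)) : ℝ)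
      linarith
    have h0 : (0 : ℝ) ≤ 1 - 1 / (4 * n) := by
      rw [sub_nonneg, div_le_one (by positivity)]
      have : (1 : ℝ) ≤ n := by exact_mod_cast hn
      linarith
    calc (1 - 1 / (4 * n) : ℝ) ^ (16 * n ^ 4)
        ≤ Real.exp (-(1 / (4 * n))) ^ (16 * n ^ 4) := pow_le_pow_left₀ h0 h3 _
      _ = Real.exp (-1) ^ (4 * n ^ 3) := by
        rw [← Real.exp_nat_mul, ← Real.exp_nat_mul]
        congr 1
        push_cast
        field_simp
        ring
      _ ≤ (1 / 2) ^ (4 * n ^ 3) := by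
        refine pow_le_pow_left₀ (Real.exp_pos _).le ?_ _
        rw [Real.exp_neg, one_div]
        refine inv_anti₀ (by norm_num) ?_
        have := Real.add_one_le_exp (1 : ℝ)
        linarith
  have h4 : (n : ℝ) * n ^ (n * n) * 2 ^ n ≤ 2 ^ (4 * n ^ 3 - 1) := by
    calc (n : ℝ) * n ^ (n * n) * 2 ^ n ≤ 2 ^ n * (2 ^ n) ^ (n * n) * 2 ^ n := by gcongr
      _ = 2 ^ (n + n * (n * n) + n) := by rw [← pow_mul, pow_add, pow_add]
      _ ≤ 2 ^ (4 * n ^ 3 - 1) := by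
        refine pow_le_pow_right₀ (by norm_num) ?_
        have h5 : n ≤ n ^ 3 := Nat.le_self_pow (by norm_num) n
        have h6 : n * (n * n) = n ^ 3 := by ring
        omega
  have h7 : 0 < n ^ 3 := by positivity
  calc _ = (n : ℝ) * n ^ (n * n) * 2 ^ n * (1 - 1 / (4 * n)) ^ (16 * n ^ 4) := by ring
    _ ≤ 2 ^ (4 * n ^ 3 - 1) * (1 / 2) ^ (4 * n ^ 3) := by
      refine mul_le_mul h4 h2 ?_ (by positivity)
      refine pow_nonneg ?_ _
      rw [sub_nonneg, div_le_one (by positivity)]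
      have : (1 : ℝ) ≤ n := by exact_mod_cast hn
      linarith
    _ = 1 / 2 := by
      obtain ⟨k, hk⟩ : ∃ k, 4 * n ^ 3 = k + 1 := ⟨4 * n ^ 3 - 1, by omega⟩
      rw [hk, Nat.add_sub_cancel, pow_succ, ← mul_assoc, ← mul_pow]
      norm_num

-- Union bound over the degree and the arrays of `P` only, at most `n * n ^ (n * n)` cases, because
-- the arrays of `Q` are never probed.
open scoped Classical in
theorem card_le_two_mul_card_universal (hT : T = 16 * n ^ 4) :
    Fintype.card (Choices n T)
      ≤ 2 * (Finset.univ.filter fun ω : Choices n T => IsUniversal ω).card := by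
  have hn := NeZero.pos n
  have h1 : ((Finset.univ.filter fun ω : Choices n T => ¬ IsUniversal ω).card : ℝ)
      ≤ Fintype.card (Choices n T) * (1 / 2) := by
    have hsub : (Finset.univ.filter fun ω : Choices n T => ¬ IsUniversal ω) ⊆
        Finset.univ.biUnion fun e : Fin n =>
          (Finset.univ.filter fun L : Fin n → Fin (e + 1) → Fin n => Regular L).biUnion fun L =>
            Finset.univ.filter fun ω : Choices n T => finalDeficit e L ω ≠ 0 := by
      intro ω hω
      simp only [IsUniversal, Finset.mem_filter, Finset.mem_univ, true_and, not_forall] at hω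
      obtain ⟨e, L, hL, h⟩ := hω
      simp only [Finset.mem_biUnion, Finset.mem_filter, Finset.mem_univ, true_and]
      exact ⟨e, L, hL, h⟩
    set q : ℝ := Fintype.card (Choices n T) * (2 ^ n * (1 - 1 / (4 * n)) ^ T) with hq
    have hn1 : (1 : ℝ) ≤ n := by exact_mod_cast hn
    have hq0 : 0 ≤ q := by
      have : (0 : ℝ) ≤ 1 - 1 / (4 * n) := by
        rw [sub_nonneg, div_le_one (by positivity)]
        linarith
      positivity
    have hL : ∀ e : Fin n, (((Finset.univ.filter fun L : Fin n → Fin (e + 1) → Fin n =>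
        Regular L).biUnion fun L => Finset.univ.filter fun ω : Choices n T =>
          finalDeficit e L ω ≠ 0).card : ℝ) ≤ n ^ (n * n) * q := by
      intro e
      have hcard : ((Finset.univ.filter fun L : Fin n → Fin (e + 1) → Fin n =>
          Regular L).card : ℝ) ≤ n ^ (n * n) := by
        have h2 : (Finset.univ.filter fun L : Fin n → Fin (e + 1) → Fin n =>
          Regular L).card ≤ n ^ (n * n) := by
          refine (Finset.card_le_univ _).trans ?_
          simp only [Fintype.card_fun, Fintype.card_fin, ← pow_mul]
          exact Nat.pow_le_pow_right hn (Nat.mul_le_mul_right _ e.isLt)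
        exact_mod_cast h2
      calc _ ≤ ((∑ L ∈ Finset.univ.filter fun L : Fin n → Fin (e + 1) → Fin n => Regular L,
            (Finset.univ.filter fun ω : Choices n T => finalDeficit e L ω ≠ 0).card : ℕ) : ℝ) := by
            exact_mod_cast Finset.card_biUnion_le
        _ ≤ ∑ L ∈ Finset.univ.filter fun L : Fin n → Fin (e + 1) → Fin n => Regular L, q := by
            push_cast
            exact Finset.sum_le_sum fun L hL => card_finalDeficit_le (Finset.mem_filter.1 hL).2
        _ ≤ _ := by
            rw [Finset.sum_const, nsmul_eq_mul]
            gcongr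
    calc _ ≤ ((∑ e : Fin n, ((Finset.univ.filter fun L : Fin n → Fin (e + 1) → Fin n =>
            Regular L).biUnion fun L => Finset.univ.filter fun ω : Choices n T =>
            finalDeficit e L ω ≠ 0).card : ℕ) : ℝ) := by
          exact_mod_cast (Finset.card_le_card hsub).trans Finset.card_biUnion_le
      _ ≤ ∑ e : Fin n, (n ^ (n * n) * q : ℝ) := by
          push_cast
          exact Finset.sum_le_sum fun e _ => hL e
      _ = Fintype.card (Choices n T) *
          (n * n ^ (n * n) * (2 ^ n * (1 - 1 / (4 * n)) ^ (16 * n ^ 4))) := by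
          rw [Finset.sum_const, nsmul_eq_mul, Finset.card_univ, Fintype.card_fin, hq, hT]
          ring
      _ ≤ _ := mul_le_mul_of_nonneg_left (failure_bound n hn) (by positivity)
  have h2 := Finset.card_filter_add_card_filter_not (s := (Finset.univ : Finset (Choices n T)))
    (fun ω => IsUniversal ω)
  rw [Finset.card_univ] at h2
  have h3 : 2 * (Finset.univ.filter fun ω : Choices n T => ¬ IsUniversal ω).card
      ≤ Fintype.card (Choices n T) := by
    have : (2 : ℝ) * (Finset.univ.filter fun ω : Choices n T => ¬ IsUniversal ω).card
      ≤ Fintype.card (Choices n T) := by linarith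
    exact_mod_cast this
  omega

/-- The cost of all rounds on the input `I`. -/
def Input.cost (I : Input n) (ω : Choices n T) : ℕ :=
  totalCost ⟨I.d - 1, by have := I.d_le; have := I.d_pos; omega⟩ I.leftArrays ω

/-- Costs are nonnegative and universal choices make up at least half of all, so their mean cost is
at most twice the overall mean, and some choice does no worse than the mean. -/
theorem exists_universal_choices (hT : T = 16 * n ^ 4) (μ : PMF (Input n)) :
    ∃ ω : Choices n T, IsUniversal ω ∧
      ∑' I, μ I * (I.cost ω : ℝ≥0∞) ≤ 2 * ENNReal.ofReal (4 * n * harmonic n) := by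
  classical
  set m := ENNReal.ofReal (4 * n * harmonic n) with hm
  by_contra! hcon
  have hsum : ∑ ω : Choices n T, ∑' I, μ I * (I.cost ω : ℝ≥0∞)
      ≤ Fintype.card (Choices n T) * m := by
    rw [← Summable.tsum_finsetSum fun _ _ => ENNReal.summable]
    have hI : ∀ I : Input n, ∑ ω : Choices n T, μ I * (I.cost ω : ℝ≥0∞)
        ≤ μ I * (Fintype.card (Choices n T) * m) := by
      intro I
      rw [← Finset.mul_sum]
      gcongr
      have h1 : ∑ ω : Choices n T, (I.cost ω : ℝ)
          ≤ Fintype.card (Choices n T) * (4 * n * harmonic n) :=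
        sum_totalCost_le I.regular_leftArrays
      have h2 := ENNReal.ofReal_le_ofReal h1
      rw [ENNReal.ofReal_mul (by positivity), ENNReal.ofReal_natCast] at h2
      refine le_trans (le_of_eq ?_) h2
      rw [← Nat.cast_sum, ← Nat.cast_sum, ENNReal.ofReal_natCast]
    refine (ENNReal.tsum_le_tsum hI).trans ?_
    rw [ENNReal.tsum_mul_right, μ.tsum_coe, one_mul]
  have hcard := card_le_two_mul_card_universal hT
  set G := Finset.univ.filter fun ω : Choices n T => IsUniversal ω with hG
  have hpos : 0 < Fintype.card (Choices n T) := Fintype.card_pos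
  have hne : G.Nonempty := Finset.card_pos.1 (by omega)
  have hlt := ENNReal.sum_lt_sum_of_nonempty hne
    (f := fun _ => 2 * m) (fun ω hω => hcon ω (Finset.mem_filter.1 hω).2)
  refine absurd hlt (not_lt.2 ?_)
  calc _ ≤ ∑ ω : Choices n T, ∑' I, μ I * (I.cost ω : ℝ≥0∞) :=
        Finset.sum_le_sum_of_subset (Finset.filter_subset _ _)
    _ ≤ Fintype.card (Choices n T) * m := hsum
    _ ≤ ((2 * G.card : ℕ) : ℝ≥0∞) * m := by gcongr
    _ = ∑ ω ∈ G, 2 * m := by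
      rw [Finset.sum_const, nsmul_eq_mul]
      push_cast
      ring

end Average

/-! ### The table of constants -/

section Table

variable {n T : ℕ}

/-- The entry for the degree `e + 1`, the round `r` and the position `t` within the round. -/
def cell (ω : Choices n T) (e r t : ℕ) : ℕ :=
  if h : e < n ∧ r < T then
    match t with
    | 0 => (ω ⟨e, h.1⟩ ⟨r, h.2⟩).1
    | t + 1 => if ht : t < 2 * n then (ω ⟨e, h.1⟩ ⟨r, h.2⟩).2 ⟨t, ht⟩ else 0
  else 0

/-- The table of all choices. -/
def table (ω : Choices n T) : List ℕ :=
  (List.range (n * T * (2 * n + 1))).map fun j =>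
    cell ω (j / (2 * n + 1) / T) (j / (2 * n + 1) % T) (j % (2 * n + 1))

theorem cell_le (ω : Choices n T) (e r t : ℕ) : cell ω e r t ≤ n := by
  unfold cell
  split_ifs with h
  · cases t with
    | zero => exact (ω ⟨e, h.1⟩ ⟨r, h.2⟩).1.isLt.le
    | succ t =>
      simp only
      split_ifs with ht
      · have := ((ω ⟨e, h.1⟩ ⟨r, h.2⟩).2 ⟨t, ht⟩).isLt
        simp only at this
        omega
      · exact Nat.zero_le _
  · exact Nat.zero_le _

theorem table_getD (ω : Choices n T) {e r t : ℕ} (he : e < n) (hr : r < T) (ht : t < 2 * n + 1) :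
    (table ω).getD ((e * T + r) * (2 * n + 1) + t) 0 = cell ω e r t := by
  have h1 : ((e * T + r) * (2 * n + 1) + t) / (2 * n + 1) = e * T + r := by
    rw [mul_comm, Nat.mul_add_div (by omega), Nat.div_eq_of_lt ht, add_zero]
  have h2 : ((e * T + r) * (2 * n + 1) + t) % (2 * n + 1) = t := by
    rw [mul_comm, Nat.mul_add_mod, Nat.mod_eq_of_lt ht]
  have h3 : (e * T + r) / T = e := by
    rw [mul_comm, Nat.mul_add_div (by omega), Nat.div_eq_of_lt hr, add_zero]
  have h4 : (e * T + r) % T = r := by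
    rw [mul_comm, Nat.mul_add_mod, Nat.mod_eq_of_lt hr]
  have h5 : (e * T + r) * (2 * n + 1) + t < n * T * (2 * n + 1) := by
    have h6 : e * T + r + 1 ≤ n * T :=
      calc e * T + r + 1 ≤ (e + 1) * T := by rw [add_mul]; omega
        _ ≤ n * T := Nat.mul_le_mul_right _ he
    have h7 := Nat.mul_le_mul_right (2 * n + 1) h6
    rw [add_mul _ 1] at h7
    omega
  rw [table, List.getD_eq_getElem _ _ (by simpa using h5)]
  simp [h1, h2, h3, h4]

theorem findsPerfectMatching [NeZero n] {w : ℕ} (hT : T = 16 * n ^ 4) (hw : 4 * n + 4 ≤ 2 ^ w)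
    (hwT : n * T * (2 * n + 1) < 2 ^ w) {ω : Choices n T} (hω : IsUniversal ω) (I : Input n) :
    ∃ t, FindsPerfectMatchingIn I w (table ω) matchingProg t ∧ t ≤ 21 * I.cost ω + 15 := by
  have hdn := I.d_le
  have hend := hω ⟨I.d - 1, by have := I.d_pos; omega⟩ I.leftArrays I.regular_leftArrays
  rcases I with ⟨d, hd, G, A⟩
  obtain ⟨e, rfl⟩ := Nat.exists_eq_succ_of_ne_zero (Nat.one_le_iff_ne_zero.1 hd)
  have hen : e < n := hdn
  refine exec_matchingProg (I := ⟨e + 1, hd, G, A⟩) hdn hT hw hwT (ω ⟨e, hen⟩) ?_ ?_ hend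
  · intro r
    have := table_getD ω hen r.isLt (Nat.succ_pos (2 * n))
    rw [add_zero] at this
    refine this.trans ?_
    simp [cell, hen]
  · intro r t
    have := table_getD ω hen r.isLt (Nat.succ_lt_succ t.isLt)
    -- Word 0 of a round holds the start node, so edge `t` sits at position `t + 1`.
    rw [show (((e + 1 - 1) * T + r) * (2 * n + 1) + 1 + t) =
      ((e * T + r) * (2 * n + 1) + (t + 1)) by rw [Nat.add_sub_cancel]; ring]
    refine this.trans ?_
    simp [cell, hen]

end Table

/-! ### Numerical estimates. -/

theorem word_bounds {n : ℕ} (hn : 2 ≤ n) :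
    4 * n + 4 ≤ 2 ^ wordBits 12 n ∧ n * (16 * n ^ 4) * (2 * n + 1) < 2 ^ wordBits 12 n := by
  have h : 2 ^ wordBits 12 n = (2 ^ n.size) ^ 12 := by
    rw [wordBits, mul_comm, pow_mul]
  have h1 : n < 2 ^ n.size := Nat.lt_size_self n
  have h2 : 4 ≤ 2 ^ n.size := by
    have : 1 < n.size := Nat.lt_size.2 hn
    calc 4 = 2 ^ 2 := rfl
      _ ≤ 2 ^ n.size := Nat.pow_le_pow_right (by norm_num) this
  rw [h]
  generalize 2 ^ n.size = N at h1 h2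
  constructor
  · calc 4 * n + 4 ≤ 4 * N := by omega
      _ ≤ N * N := Nat.mul_le_mul_right _ h2
      _ = N ^ 2 := by ring
      _ ≤ N ^ 12 := Nat.pow_le_pow_right (by omega) (by norm_num)
  -- Each constant factor 4 is absorbed by one more factor `N`, which gives `N ^ 9`; the word length
  -- factor 12 is generous.
  · calc n * (16 * n ^ 4) * (2 * n + 1) ≤ N * ((4 * 4) * N ^ 4) * (4 * N) := by
          gcongr
          omega
      _ ≤ N * ((N * N) * N ^ 4) * (N * N) := by gcongr
      _ = N ^ 9 := by ring
      _ < N ^ 12 := Nat.pow_lt_pow_right (by omega) (by norm_num)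

/-- With `harmonic n ≤ 3 * log n` the main term is at most `504 * n * log n`. The remaining `96 * n
* log n` exceeds 15 because `n * log n ≥ 1.38`. -/
theorem cost_bound {n : ℕ} (hn : 2 ≤ n) :
    21 * (2 * (4 * n * harmonic n)) + 15 ≤ 600 * ((n : ℝ) * Real.log n) := by
  have h1 := harmonic_le_one_add_log n
  have hn' : (2 : ℝ) ≤ n := by exact_mod_cast hn
  have h2 : (0.69 : ℝ) ≤ Real.log n := by
    have := Real.log_two_gt_d9
    have := Real.log_le_log (by norm_num) hn'
    linarith
  have h3 : (harmonic n : ℝ) ≤ 3 * Real.log n := by linarith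
  have h4 : (n : ℝ) * harmonic n ≤ n * (3 * Real.log n) := by gcongr
  have h5 : (2 : ℝ) * 0.69 ≤ n * Real.log n := by gcongr
  linarith

end RegMatch

theorem mainTheorem6 :
    ∃ (p : RegMatch.Prog) (K : ℕ) (C : ℝ), ∀ n : ℕ, 2 ≤ n →
      ∀ μ : PMF (RegMatch.Input n),
        ∃ tbl : List ℕ,
          tbl.length ≤ 2 ^ RegMatch.wordBits K n ∧
          (∀ c ∈ tbl, c < 2 ^ RegMatch.wordBits K n) ∧
          ∃ time : RegMatch.Input n → ℕ,
            (∀ I : RegMatch.Input n,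
              RegMatch.FindsPerfectMatchingIn I (RegMatch.wordBits K n) tbl p (time I)) ∧
            ∑' I : RegMatch.Input n, μ I * (time I : ℝ≥0∞) ≤
              ENNReal.ofReal (C * ((n : ℝ) * Real.log (n : ℝ))) := by
  refine ⟨RegMatch.matchingProg, 12, 600, fun n hn μ => ?_⟩
  have : NeZero n := ⟨by omega⟩
  obtain ⟨hw, hwT⟩ := RegMatch.word_bounds hn
  obtain ⟨ω, hω, havg⟩ := RegMatch.exists_universal_choices (T := 16 * n ^ 4) rfl μ
  choose time htime hle using RegMatch.findsPerfectMatching rfl hw hwT hω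
  refine ⟨RegMatch.table ω, ?_, ?_, time, htime, ?_⟩
  · simpa [RegMatch.table] using hwT.le
  · intro c hc
    obtain ⟨j, _, rfl⟩ := List.mem_map.1 hc
    exact (RegMatch.cell_le _ _ _ _).trans_lt (by omega)
  · have hH : (0 : ℝ) ≤ 4 * n * harmonic n := by
      have : (0 : ℚ) ≤ harmonic n := (harmonic_pos (by omega)).le
      have : (0 : ℝ) ≤ harmonic n := by exact_mod_cast this
      positivity
    calc ∑' I, μ I * (time I : ℝ≥0∞)
        ≤ ∑' I, (21 * (μ I * (I.cost ω : ℝ≥0∞)) + μ I * 15) := by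
          refine ENNReal.tsum_le_tsum fun I => ?_
          calc μ I * (time I : ℝ≥0∞) ≤ μ I * ((21 * I.cost ω + 15 : ℕ) : ℝ≥0∞) := by
                gcongr
                exact hle I
            _ = _ := by push_cast; ring
      _ = 21 * ∑' I, μ I * (I.cost ω : ℝ≥0∞) + 15 := by
          rw [ENNReal.tsum_add, ENNReal.tsum_mul_left, ENNReal.tsum_mul_right, μ.tsum_coe, one_mul]
      _ ≤ 21 * (2 * ENNReal.ofReal (4 * n * harmonic n)) + 15 := by gcongr
      _ = ENNReal.ofReal (21 * (2 * (4 * n * harmonic n)) + 15) := by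
          rw [ENNReal.ofReal_add (by positivity) (by norm_num),
            ENNReal.ofReal_mul (p := 21) (by norm_num), ENNReal.ofReal_mul (p := 2) (by norm_num)]
          norm_num
      _ ≤ _ := ENNReal.ofReal_le_ofReal (RegMatch.cost_bound hn)
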